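/- **Setting.** A *semimetric* on a set $X$ is a map $d\colon X\times X\to[0,\infty]$ with $d(x,y)=0$ if and only if $x=y$, and $d(x,y)\le d(x,z)+d(z,y)$ for all $x,y,z\in X$ (symmetry is not required). For $x\in X$ and real $r\ge 0$ put $B^+_r(x)=\{y: d(x,y)\le r\}$ (out-ball) and $B^-_r(x)=\{y: d(y,x)\le r\}$ (in-ball); for $S\subseteq X$ put $B^\pm_r(S)=\bigcup_{x\in S}B^\pm_r(x)$. The forward (backward) topology of $X$ is generated by the sets $\{y: d(x,y)<r\}$ (respectively $\{y: d(y,x)<r\}$). Real intervals carry the forward and backward topologies of the directed line, i.e. of the semimetric $(s,t)\mapsto t-s$ if $s\le t$ and $\infty$ otherwise. A *directed path* is a map $P\colon[a,b]\to X$, $a<b$, that is continuous with respect to the forward topologies and with respect to the backward topologies. It is directed from $P(a)$ to $P(b)$, and its *length* is $\ell(P)=\lim_{N\to\infty}\sum_{i=1}^N d(P(t_{i-1}),P(t_i))$ with $t_i=a+i(b-a)/N$. It is a *geodesic* if $\ell(P)=d(P(a),P(b))$. The space $X$ is *geodesic* if there is a geodesic from $x$ to $y$ whenever $d(x,y)<\infty$.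 A geodesic space $X$ is *hyperbolic* if there is $\delta\ge0$ such that for all $x,y,z\in X$, every geodesic $P$ from $x$ to $y$, every geodesic $Q$ between $x$ and $z$ (in either direction) and every geodesic $R$ between $y$ and $z$ (in either direction), the image of $P$ is contained in $B^+_\delta(Q)\cup B^-_\delta(R)$. (B1) There is $f\colon\mathbb R\to\mathbb R$ such that for all $x\in X$, $r\ge0$ and $y,z\in B^+_r(x)$, either $d(y,z)=\infty$ or $d(y,z)\le f(r)$. (B2) The same with $B^-_r(x)$ in place of $B^+_r(x)$. A *ray* is a map $R\colon[0,\infty)\to X$, continuous with respect to the forward and with respect to the backward topologies, such that for all $x\in X$ and $r\ge0$ there is $p\ge0$ with $R([p,\infty))\cap B^+_r(x)=\emptyset$. An *anti-ray* is a map $R\colon(-\infty,0]\to X$, continuous in the same sense, such that for all $x\in X$ and $r\ge0$ there is $p\le0$ with $R((-\infty,p])\cap B^-_r(x)=\emptyset$. A ray or anti-ray $R$ is *quasi-geodesic* if there are $\gamma\ge1$ and $c\ge0$ with $\ell(R|_{[s,t]})\le\gamma\, d(R(s),R(t))+c$ for all $s<t$ in its domain. For quasi-geodesic rays or anti-rays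 $R_1,R_2$, write $R_1\le R_2$ if there is $M\ge0$ such that for every $r\ge0$ and every $x\in X$ there is a directed path of length at most $M$ from a point of $R_1$ to a point of $R_2$ none of whose points lies in $B^+_r(x)\cup B^-_r(x)$. **Proposition.** Let $X$ be a hyperbolic geodesic semimetric space that satisfies (B1) and (B2). Then $\le$ is a quasiorder (a reflexive and transitive relation) on the set of all quasi-geodesic rays and anti-rays of $X$. -/

import Mathlib

open scoped NNReal ENNReal

namespace Semi

/-! ## Semimetrics and their two topologies -/

/-- A semimetric on `X`: an extended distance that need not be symmetric. -/
structure IsSemimetric {X : Type*} (d : X → X → ℝ≥0∞) : Prop where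
  eq_zero_iff : ∀ x y, d x y = 0 ↔ x = y
  triangle : ∀ x y z, d x y ≤ d x z + d z y

/-- The out-ball of radius `r` around `x`. -/
def outBall {X : Type*} (d : X → X → ℝ≥0∞) (x : X) (r : ℝ≥0) : Set X := {y | d x y ≤ r}

/-- The in-ball of radius `r` around `x`. -/
def inBall {X : Type*} (d : X → X → ℝ≥0∞) (x : X) (r : ℝ≥0) : Set X := {y | d y x ≤ r}

/-- The forward topology, generated by the open out-balls. -/
@[reducible] def forwardTopology {X : Type*} (d : X → X → ℝ≥0∞) : TopologicalSpace X :=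
  TopologicalSpace.generateFrom {U | ∃ (x : X) (r : ℝ≥0), U = {y | d x y < r}}

/-- The backward topology, generated by the open in-balls. -/
@[reducible] def backwardTopology {X : Type*} (d : X → X → ℝ≥0∞) : TopologicalSpace X :=
  TopologicalSpace.generateFrom {U | ∃ (x : X) (r : ℝ≥0), U = {y | d y x < r}}

/-- The semimetric of the directed real line, on which one can only move to the right. Its forward
topology is generated by the intervals `[s, t)`, its backward topology by the intervals `(s, t]`. -/
noncomputable def lineDist (s t : ℝ) : ℝ≥0∞ := if s ≤ t then ENNReal.ofReal (t - s) else ⊤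

/-- A map from an interval `I` of the directed real line to `X` that is continuous with respect to
the forward topologies and with respect to the backward topologies. -/
def IsBicontinuousOn {X : Type*} (d : X → X → ℝ≥0∞) (P : ℝ → X) (I : Set ℝ) : Prop :=
  @ContinuousOn ℝ X (forwardTopology lineDist) (forwardTopology d) P I ∧
    @ContinuousOn ℝ X (backwardTopology lineDist) (backwardTopology d) P I

/-! ## Directed paths, length, geodesics

A path on `[a, b]` (a ray on `[0, ∞)`, an anti-ray on `(-∞, 0]`) is represented by a map on `ℝ`;
only its values on the interval matter. -/

/-- `P` restricted to `[a, b]` is a directed path. -/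
def IsDirectedPath {X : Type*} (d : X → X → ℝ≥0∞) (P : ℝ → X) (a b : ℝ) : Prop :=
  a < b ∧ IsBicontinuousOn d P (Set.Icc a b)

/-- The sum of the distances between consecutive points of `P` at the uniform partition of `[a, b]`
into `N` pieces. -/
noncomputable def gridSum {X : Type*} (d : X → X → ℝ≥0∞) (P : ℝ → X) (a b : ℝ) (N : ℕ) : ℝ≥0∞ :=
  ∑ i ∈ Finset.range N,
    d (P (a + (i : ℝ) * (b - a) / N)) (P (a + ((i + 1 : ℕ) : ℝ) * (b - a) / N))

/-- The length of `P` on `[a, b]`. The limit exists for every directed path,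
see `IsDirectedPath.tendsto_gridSum`. -/
noncomputable def length {X : Type*} (d : X → X → ℝ≥0∞) (P : ℝ → X) (a b : ℝ) : ℝ≥0∞ :=
  Filter.limUnder Filter.atTop (gridSum d P a b)

/-- `P` restricted to `[a, b]` is an `x`-`y` geodesic. -/
def IsGeodesic {X : Type*} (d : X → X → ℝ≥0∞) (P : ℝ → X) (a b : ℝ) (x y : X) : Prop :=
  IsDirectedPath d P a b ∧ P a = x ∧ P b = y ∧ length d P a b = d x y

/-- `S` is the image of an `x`-`y` geodesic. -/
def IsGeodesicImage {X : Type*} (d : X → X → ℝ≥0∞) (S : Set X) (x y : X) : Prop :=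
  ∃ (P : ℝ → X) (a b : ℝ), IsGeodesic d P a b x y ∧ S = P '' Set.Icc a b

/-- There is an `x`-`y` geodesic whenever `d x y` is finite. -/
def IsGeodesicSpace {X : Type*} (d : X → X → ℝ≥0∞) : Prop :=
  ∀ x y, d x y < ⊤ → ∃ (P : ℝ → X) (a b : ℝ), IsGeodesic d P a b x y

/-! ## Hyperbolicity and the two boundedness conditions -/

/-- All geodesic triangles are `δ`-thin. The triangle has end points `x`, `y`, `z`; its sides are
`S` from `x` to `y`, and `S₁` between `x` and `z` and `S₂` between `y` and `z`, both directed in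
either way. -/
def IsHyperbolicWith {X : Type*} (d : X → X → ℝ≥0∞) (δ : ℝ≥0) : Prop :=
  ∀ (x y z : X) (S S₁ S₂ : Set X), IsGeodesicImage d S x y →
    (IsGeodesicImage d S₁ x z ∨ IsGeodesicImage d S₁ z x) →
    (IsGeodesicImage d S₂ y z ∨ IsGeodesicImage d S₂ z y) →
    S ⊆ (⋃ q ∈ S₁, outBall d q δ) ∪ (⋃ q ∈ S₂, inBall d q δ)

/-- `δ`-hyperbolic for some `δ ≥ 0`. -/
def IsHyperbolic {X : Type*} (d : X → X → ℝ≥0∞) : Prop := ∃ δ : ℝ≥0, IsHyperbolicWith d δ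

/-- Finite distances between two points of an out-ball of radius `r` are bounded by `f r`. -/
def BoundedOutBalls {X : Type*} (d : X → X → ℝ≥0∞) : Prop :=
  ∃ f : ℝ → ℝ, ∀ (x : X) (r : ℝ≥0), ∀ y ∈ outBall d x r, ∀ z ∈ outBall d x r,
    d y z = ⊤ ∨ d y z ≤ ENNReal.ofReal (f r)

/-- Finite distances between two points of an in-ball of radius `r` are bounded by `f r`. -/
def BoundedInBalls {X : Type*} (d : X → X → ℝ≥0∞) : Prop :=
  ∃ f : ℝ → ℝ, ∀ (x : X) (r : ℝ≥0), ∀ y ∈ inBall d x r, ∀ z ∈ inBall d x r,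
    d y z = ⊤ ∨ d y z ≤ ENNReal.ofReal (f r)

/-! ## Quasi-geodesic rays and anti-rays -/

/-- A ray, on `[0, ∞)`: it eventually leaves every out-ball. -/
def IsRay {X : Type*} (d : X → X → ℝ≥0∞) (R : ℝ → X) : Prop :=
  IsBicontinuousOn d R (Set.Ici 0) ∧
    ∀ (x : X) (r : ℝ≥0), ∃ p : ℝ, 0 ≤ p ∧ R '' Set.Ici p ∩ outBall d x r = ∅

/-- An anti-ray, on `(-∞, 0]`: backwards, it eventually leaves every in-ball. -/
def IsAntiRay {X : Type*} (d : X → X → ℝ≥0∞) (R : ℝ → X) : Prop :=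
  IsBicontinuousOn d R (Set.Iic 0) ∧
    ∀ (x : X) (r : ℝ≥0), ∃ p : ℝ, p ≤ 0 ∧ R '' Set.Iic p ∩ inBall d x r = ∅

/-- Every directed subpath of `P` over the interval `I` is at most `γ` times as long, up to the
additive constant `c`, as the distance from its starting point to its end point. -/
def IsQuasiGeodesicOn {X : Type*} (d : X → X → ℝ≥0∞) (γ c : ℝ≥0) (P : ℝ → X) (I : Set ℝ) : Prop :=
  ∀ s ∈ I, ∀ t ∈ I, s < t → length d P s t ≤ γ * d (P s) (P t) + c

/-- A `(γ, c)`-quasi-geodesic ray for some `γ ≥ 1` and `c ≥ 0`. -/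
def IsQuasiGeodesicRay {X : Type*} (d : X → X → ℝ≥0∞) (R : ℝ → X) : Prop :=
  IsRay d R ∧ ∃ γ c : ℝ≥0, 1 ≤ γ ∧ IsQuasiGeodesicOn d γ c R (Set.Ici 0)

/-- A `(γ, c)`-quasi-geodesic anti-ray for some `γ ≥ 1` and `c ≥ 0`. -/
def IsQuasiGeodesicAntiRay {X : Type*} (d : X → X → ℝ≥0∞) (R : ℝ → X) : Prop :=
  IsAntiRay d R ∧ ∃ γ c : ℝ≥0, 1 ≤ γ ∧ IsQuasiGeodesicOn d γ c R (Set.Iic 0)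

/-- The quasi-geodesic rays and anti-rays. -/
abbrev RayOrAntiRay {X : Type*} (d : X → X → ℝ≥0∞) : Type _ :=
  {R : ℝ → X // IsQuasiGeodesicRay d R} ⊕ {R : ℝ → X // IsQuasiGeodesicAntiRay d R}

/-- The set of points on a quasi-geodesic ray or anti-ray. -/
def trace {X : Type*} (d : X → X → ℝ≥0∞) : RayOrAntiRay d → Set X :=
  Sum.elim (fun R => R.1 '' Set.Ici 0) (fun R => R.1 '' Set.Iic 0)

/-- The relation `R₁ ≤ R₂`: for some `M`, outside of any `B⁺_r(x) ∪ B⁻_r(x)` there is a directed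
`R₁`-`R₂` path of length at most `M`. -/
def RayLE {X : Type*} (d : X → X → ℝ≥0∞) (R₁ R₂ : RayOrAntiRay d) : Prop :=
  ∃ M : ℝ≥0, ∀ (r : ℝ≥0) (x : X), ∃ (P : ℝ → X) (a b : ℝ), IsDirectedPath d P a b ∧
    P a ∈ trace d R₁ ∧ P b ∈ trace d R₂ ∧ length d P a b ≤ M ∧
    ∀ t ∈ Set.Icc a b, P t ∉ outBall d x r ∪ inBall d x r

/-! ## The limit that defines the length exists -/

theorem IsSemimetric.flip {X : Type*} {d : X → X → ℝ≥0∞} (hd : IsSemimetric d) :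
    IsSemimetric (fun x y => d y x) where
  eq_zero_iff x y := by rw [hd.eq_zero_iff, eq_comm]
  triangle x y z := by rw [add_comm]; exact hd.triangle y x z

theorem isSemimetric_lineDist : IsSemimetric lineDist where
  eq_zero_iff x y := by
    unfold lineDist
    split_ifs with h
    · rw [ENNReal.ofReal_eq_zero]
      constructor <;> intro h' <;> linarith
    · simp only [ENNReal.top_ne_zero, false_iff]
      rintro rfl
      exact h le_rfl
  triangle x y z := by
    unfold lineDist
    by_cases h1 : x ≤ z
    · by_cases h2 : z ≤ y
      · rw [if_pos h1, if_pos h2, if_pos (h1.trans h2), ← ENNReal.ofReal_add (by linarith)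
          (by linarith)]
        exact ENNReal.ofReal_le_ofReal (by linarith)
      · rw [if_neg h2]; simp
    · rw [if_neg h1]; simp

theorem IsSemimetric.mem_nhds_iff {X : Type*} {d : X → X → ℝ≥0∞} (hd : IsSemimetric d) (x : X)
    (U : Set X) :
    U ∈ @nhds X (forwardTopology d) x ↔ ∃ ε : ℝ≥0, 0 < ε ∧ {y | d x y < ε} ⊆ U := by
  let _ := forwardTopology d
  constructor
  · intro h
    obtain ⟨V, hVU, hV, hx⟩ := _root_.mem_nhds_iff.1 h
    suffices H : ∀ V, TopologicalSpace.GenerateOpen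
        {U | ∃ (x : X) (r : ℝ≥0), U = {y | d x y < r}} V → x ∈ V →
        ∃ ε : ℝ≥0, 0 < ε ∧ {y | d x y < ε} ⊆ V by
      obtain ⟨ε, h0, h1⟩ := H V hV hx
      exact ⟨ε, h0, h1.trans hVU⟩
    clear hx hV hVU V h
    intro V hV
    induction hV with
    | basic s hs =>
      obtain ⟨z, r, rfl⟩ := hs
      intro hx
      have hx : d z x < r := hx
      lift d z x to ℝ≥0 using (hx.trans ENNReal.coe_lt_top).ne with e he
      have her : e < r := by exact_mod_cast hx
      refine ⟨r - e, tsub_pos_of_lt her, fun y hy => ?_⟩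
      have hy : d x y < (r - e : ℝ≥0) := hy
      calc d z y ≤ d z x + d x y := hd.triangle z y x
        _ < e + (r - e : ℝ≥0) := by
          rw [← he]; exact (ENNReal.add_lt_add_iff_left ENNReal.coe_ne_top).2 hy
        _ = r := by rw [← ENNReal.coe_add, add_tsub_cancel_of_le her.le]
    | univ => intro _; exact ⟨1, one_pos, Set.subset_univ _⟩
    | inter s t _ _ hs ht =>
      rintro ⟨h1, h2⟩
      obtain ⟨e, he, hes⟩ := hs h1
      obtain ⟨e', he', hes'⟩ := ht h2
      refine ⟨min e e', lt_min he he', fun y hy => ?_⟩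
      have hy : d x y < ((min e e' : ℝ≥0) : ℝ≥0∞) := hy
      exact ⟨hes (hy.trans_le (by exact_mod_cast min_le_left e e')),
        hes' (hy.trans_le (by exact_mod_cast min_le_right e e'))⟩
    | sUnion S _ ih =>
      rintro ⟨s, hs, hxs⟩
      obtain ⟨e, he, hes⟩ := ih s hs hxs
      exact ⟨e, he, hes.trans (Set.subset_sUnion_of_mem hs)⟩
  · rintro ⟨ε, h0, h1⟩
    refine _root_.mem_nhds_iff.2 ⟨_, h1, TopologicalSpace.isOpen_generateFrom_of_mem ⟨x, ε, rfl⟩, ?_⟩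
    have : d x x = 0 := (hd.eq_zero_iff x x).2 rfl
    simpa [this] using h0

theorem continuousOn_iff_of_isSemimetric {Y X : Type*} {e : Y → Y → ℝ≥0∞} {d : X → X → ℝ≥0∞}
    (he : IsSemimetric e) (hd : IsSemimetric d) (P : Y → X) (I : Set Y) :
    @ContinuousOn Y X (forwardTopology e) (forwardTopology d) P I ↔
      ∀ s ∈ I, ∀ ε : ℝ≥0, 0 < ε → ∃ η : ℝ≥0, 0 < η ∧ ∀ t ∈ I, e s t < η → d (P s) (P t) < ε := by
  let _ := forwardTopology e
  let _ := forwardTopology d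
  refine forall₂_congr fun s _ => ?_
  constructor
  · intro h ε hε
    have h1 := h ((hd.mem_nhds_iff (P s) {y | d (P s) y < ε}).2 ⟨ε, hε, le_rfl⟩)
    rw [Filter.mem_map, mem_nhdsWithin_iff_exists_mem_nhds_inter] at h1
    obtain ⟨u, hu, hu'⟩ := h1
    obtain ⟨η, h0, hη⟩ := (he.mem_nhds_iff s u).1 hu
    exact ⟨η, h0, fun t ht hst => hu' ⟨hη hst, ht⟩⟩
  · intro h U hU
    obtain ⟨ε, hε, hεU⟩ := (hd.mem_nhds_iff _ _).1 hU
    obtain ⟨η, h0, hη⟩ := h ε hε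
    rw [Filter.mem_map, mem_nhdsWithin_iff_exists_mem_nhds_inter]
    exact ⟨_, (he.mem_nhds_iff s _).2 ⟨η, h0, le_rfl⟩, fun t ht => hεU (hη t ht.2 ht.1)⟩

/-- Bicontinuity spelled out: `d (P s) (P t)` is small if `t` is slightly to the right of `s`, for
fixed `s` as well as for fixed `t`. -/
theorem isBicontinuousOn_iff {X : Type*} {d : X → X → ℝ≥0∞} (hd : IsSemimetric d) (P : ℝ → X)
    (I : Set ℝ) :
    IsBicontinuousOn d P I ↔
      (∀ s ∈ I, ∀ ε : ℝ≥0, 0 < ε → ∃ η : ℝ≥0, 0 < η ∧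
        ∀ t ∈ I, s ≤ t → t < s + η → d (P s) (P t) < ε) ∧
      (∀ t ∈ I, ∀ ε : ℝ≥0, 0 < ε → ∃ η : ℝ≥0, 0 < η ∧
        ∀ s ∈ I, s ≤ t → t < s + η → d (P s) (P t) < ε) := by
  have key : ∀ (s t : ℝ) (η : ℝ≥0), lineDist s t < η ↔ s ≤ t ∧ t < s + η := by
    intro s t η
    unfold lineDist
    split_ifs with h
    · rw [ENNReal.ofReal_lt_coe_iff (by linarith)]
      constructor
      · intro h'; exact ⟨h, by linarith⟩
      · intro h'; linarith [h'.2]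
    · simp [h]
  unfold IsBicontinuousOn
  have h2 := continuousOn_iff_of_isSemimetric isSemimetric_lineDist.flip hd.flip P I
  rw [continuousOn_iff_of_isSemimetric isSemimetric_lineDist hd]
  refine and_congr ?_ (h2.trans ?_) <;> simp only [key, and_imp]

theorem le_add_sum_add {X : Type*} {d : X → X → ℝ≥0∞} (hd : IsSemimetric d) (g : ℕ → X) (x y : X)
    {k m : ℕ} (h : k ≤ m) :
    d x y ≤ d x (g k) + ∑ i ∈ Finset.Ico k m, d (g i) (g (i + 1)) + d (g m) y := by
  have h1 : d (g k) (g m) ≤ ∑ i ∈ Finset.Ico k m, d (g i) (g (i + 1)) := by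
    induction m, h using Nat.le_induction with
    | base => simp [(hd.eq_zero_iff (g k) (g k)).2 rfl]
    | succ m hkm ih =>
      rw [Finset.sum_Ico_succ_top hkm]
      exact (hd.triangle _ _ (g m)).trans (by gcongr)
  calc d x y ≤ d x (g m) + d (g m) y := hd.triangle _ _ _
    _ ≤ _ := by gcongr; exact (hd.triangle _ _ (g k)).trans (by gcongr)

/-- The supremum, over all partitions of `[a, b]`, of the sums of consecutive distances. -/
noncomputable def variation {X : Type*} (d : X → X → ℝ≥0∞) (P : ℝ → X) (a b : ℝ) : ℝ≥0∞ :=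
  ⨆ p : ℕ × {u : ℕ → ℝ // Monotone u ∧ ∀ i, u i ∈ Set.Icc a b},
    ∑ i ∈ Finset.range p.1, d (P (p.2.1 i)) (P (p.2.1 (i + 1)))

theorem gridSum_le_variation {X : Type*} (d : X → X → ℝ≥0∞) (P : ℝ → X) {a b : ℝ} (hab : a < b)
    (N : ℕ) : gridSum d P a b N ≤ variation d P a b := by
  rcases Nat.eq_zero_or_pos N with rfl | hN
  · simp [gridSum]
  have hN' : (0 : ℝ) < N := by exact_mod_cast hN
  have hba : 0 < b - a := by linarith
  have hmono : Monotone fun i : ℕ => min b (a + (i : ℝ) * (b - a) / N) := by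
    intro i j hij
    have : (i : ℝ) ≤ j := by exact_mod_cast hij
    dsimp only
    gcongr
  have hmem : ∀ i : ℕ, min b (a + (i : ℝ) * (b - a) / N) ∈ Set.Icc a b := fun i =>
    ⟨le_min hab.le (by have : 0 ≤ (i : ℝ) * (b - a) / N := by positivity
                       linarith), min_le_left _ _⟩
  have hle : ∀ i : ℕ, i ≤ N → a + (i : ℝ) * (b - a) / N ≤ b := by
    intro i hi
    have h1 : (i : ℝ) ≤ N := by exact_mod_cast hi
    have : (i : ℝ) * (b - a) / N ≤ b - a := by
      rw [div_le_iff₀ hN']; nlinarith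
    linarith
  refine le_trans (le_of_eq ?_) (le_iSup _ ⟨N, ⟨_, hmono, hmem⟩⟩)
  refine Finset.sum_congr rfl fun i hi => ?_
  have hi := Finset.mem_range.1 hi
  dsimp only
  rw [min_eq_right (hle i hi.le), min_eq_right (hle (i + 1) hi)]

theorem tendsto_gridSum_variation {X : Type*} {d : X → X → ℝ≥0∞} (hd : IsSemimetric d)
    {P : ℝ → X} {a b : ℝ} (hP : IsDirectedPath d P a b) :
    Filter.Tendsto (gridSum d P a b) Filter.atTop (nhds (variation d P a b)) := by
  obtain ⟨hab, hc⟩ := hP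
  obtain ⟨hf, hb⟩ := (isBicontinuousOn_iff hd P _).1 hc
  have hba : 0 < b - a := by linarith
  have hself : ∀ x, d x x = 0 := fun x => (hd.eq_zero_iff x x).2 rfl
  -- points of the grid and positions relative to it
  let g : ℕ → ℕ → ℝ := fun N i => a + (i : ℝ) * (b - a) / N
  let pos : ℕ → ℝ → ℝ := fun N s => (s - a) * N / (b - a)
  let A : ℕ → ℝ → ℝ≥0∞ := fun N s =>
    ∑ i ∈ Finset.range ⌊pos N s⌋₊, d (P (g N i)) (P (g N (i + 1)))
  have hpos0 : ∀ N s, s ∈ Set.Icc a b → 0 ≤ pos N s := fun N s hs =>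
    div_nonneg (mul_nonneg (by linarith [hs.1]) (by positivity)) hba.le
  have hposN : ∀ N s, s ∈ Set.Icc a b → pos N s ≤ N := fun N s hs => by
    have : (0 : ℝ) ≤ N := by positivity
    simp only [pos]; rw [div_le_iff₀ hba]; nlinarith [hs.2]
  have hgpos : ∀ N : ℕ, 0 < N → ∀ s, a + pos N s * (b - a) / N = s := by
    intro N hN s
    have : (N : ℝ) ≠ 0 := by positivity
    simp only [pos]; field_simp; ring
  have main : ∀ u : ℕ → ℝ, Monotone u → (∀ i, u i ∈ Set.Icc a b) → ∀ n : ℕ, ∀ ε : ℝ≥0, 0 < ε →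
      ∀ᶠ N in Filter.atTop,
        ∑ i ∈ Finset.range n, d (P (u i)) (P (u (i + 1))) ≤ A N (u n) + ε := by
    intro u hu hmem n
    induction n with
    | zero => intro ε _; simp
    | succ n ih =>
      intro ε hε
      rcases (hu (Nat.le_succ n)).eq_or_lt with heq | hlt
      · filter_upwards [ih ε hε] with N hN
        rw [Finset.sum_range_succ, ← Nat.succ_eq_add_one, ← heq, hself, add_zero]
        exact hN
      · have hε3 : 0 < ε / 3 := by positivity
        obtain ⟨η, hη, h1⟩ := hf (u n) (hmem n) (ε / 3) hε3
        obtain ⟨η', hη', h2⟩ := hb (u (n + 1)) (hmem (n + 1)) (ε / 3) hε3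
        have hlt : u n < u (n + 1) := hlt
        have hev : ∀ c : ℝ, 0 < c → ∀ᶠ N : ℕ in Filter.atTop, (b - a) / N < c := fun c hc =>
          (tendsto_const_div_atTop_nhds_zero_nat (b - a)).eventually (gt_mem_nhds hc)
        filter_upwards [ih (ε / 3) hε3, hev η (by exact_mod_cast hη), hev η' (by exact_mod_cast hη'),
          hev ((u (n + 1) - u n) / 2) (by linarith), Filter.eventually_gt_atTop 0]
          with N e1 e2 e3 e4 hN
        have hN' : (0 : ℝ) < N := by exact_mod_cast hN
        set k := ⌈pos N (u n)⌉₊ with hk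
        set m := ⌊pos N (u (n + 1))⌋₊ with hm
        set w := (b - a) / N with hw
        have hwpos : 0 < w := by positivity
        have hk1 : pos N (u n) ≤ k := Nat.le_ceil _
        have hk2 : (k : ℝ) < pos N (u n) + 1 := Nat.ceil_lt_add_one (hpos0 N _ (hmem n))
        have hm1 : (m : ℝ) ≤ pos N (u (n + 1)) := Nat.floor_le (hpos0 N _ (hmem _))
        have hm2 : pos N (u (n + 1)) < m + 1 := Nat.lt_floor_add_one _
        have hgw : ∀ i, g N i = a + i * w := fun i => by simp only [g, hw]; ring
        have hpw : ∀ s, a + pos N s * w = s := fun s => by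
          rw [← hgpos N hN s, hgpos N hN s]; rw [hw, ← mul_div_assoc]; exact hgpos N hN s
        have p1 := hpw (u n)
        have p2 := hpw (u (n + 1))
        have hkm : k ≤ m := by
          have : (k : ℝ) < m + 1 := by
            by_contra hcon
            push Not at hcon
            nlinarith
          exact_mod_cast Nat.lt_succ_iff.1 (by exact_mod_cast this)
        have hkmR : (k : ℝ) ≤ m := by exact_mod_cast hkm
        have q1 : u n ≤ g N k := by rw [hgw]; nlinarith
        have q2 : g N k < u n + η := by rw [hgw]; nlinarith
        have q3 : g N m ≤ u (n + 1) := by rw [hgw]; nlinarith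
        have q4 : u (n + 1) < g N m + η' := by rw [hgw]; nlinarith
        have q5 : g N k ≤ g N m := by rw [hgw, hgw]; nlinarith
        have mk : g N k ∈ Set.Icc a b :=
          ⟨(hmem n).1.trans q1, (q5.trans q3).trans (hmem _).2⟩
        have mm : g N m ∈ Set.Icc a b := ⟨mk.1.trans q5, q3.trans (hmem _).2⟩
        have r1 := (h1 _ mk q1 q2).le
        have r2 := (h2 _ mm q3 q4).le
        have r3 := le_add_sum_add hd (fun i => P (g N i)) (P (u n)) (P (u (n + 1))) hkm
        have hfl : ⌊pos N (u n)⌋₊ ≤ k := Nat.floor_le_ceil _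
        have hA : A N (u n) + ∑ i ∈ Finset.Ico k m, d (P (g N i)) (P (g N (i + 1)))
            ≤ A N (u (n + 1)) := by
          simp only [A]
          rw [← hm, ← Finset.sum_range_add_sum_Ico _ hkm]
          gcongr
        have hε' : (ε : ℝ≥0∞) = (ε / 3 : ℝ≥0) + (ε / 3 : ℝ≥0) + (ε / 3 : ℝ≥0) := by
          rw [← ENNReal.coe_add, ← ENNReal.coe_add]
          congr 1
          rw [← NNReal.coe_inj]; push_cast; ring
        rw [Finset.sum_range_succ]
        calc _ ≤ (A N (u n) + (ε / 3 : ℝ≥0)) + ((ε / 3 : ℝ≥0) +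
              ∑ i ∈ Finset.Ico k m, d (P (g N i)) (P (g N (i + 1))) + (ε / 3 : ℝ≥0)) := by
              refine add_le_add e1 (r3.trans ?_)
              gcongr
          _ = (A N (u n) + ∑ i ∈ Finset.Ico k m, d (P (g N i)) (P (g N (i + 1)))) + ε := by
              rw [hε']; ring
          _ ≤ _ := by gcongr
  refine tendsto_order.2 ⟨fun y hy => ?_, fun y hy => ?_⟩
  · obtain ⟨⟨n, u, hu, hmem⟩, hlt⟩ := lt_iSup_iff.1 hy
    obtain ⟨ε, hε, hlt'⟩ := ENNReal.lt_iff_exists_add_pos_lt.1 hlt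
    filter_upwards [main u hu hmem n ε hε] with N hN
    have hAle : A N (u n) ≤ gridSum d P a b N := by
      simp only [A, gridSum]
      refine Finset.sum_le_sum_of_subset (Finset.range_subset_range.2 ?_)
      exact Nat.floor_le_of_le (hposN N _ (hmem n))
    have : y + ε < gridSum d P a b N + ε := hlt'.trans_le (hN.trans (by gcongr))
    exact lt_of_add_lt_add_right this
  · exact Filter.Eventually.of_forall fun N => (gridSum_le_variation d P hab N).trans_lt hy

theorem IsDirectedPath.length_eq_variation {X : Type*} {d : X → X → ℝ≥0∞} (hd : IsSemimetric d)
    {P : ℝ → X} {a b : ℝ} (hP : IsDirectedPath d P a b) : length d P a b = variation d P a b :=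
  (tendsto_gridSum_variation hd hP).limUnder_eq

theorem IsDirectedPath.tendsto_gridSum {X : Type*} {d : X → X → ℝ≥0∞} (hd : IsSemimetric d)
    {P : ℝ → X} {a b : ℝ} (hP : IsDirectedPath d P a b) :
    Filter.Tendsto (gridSum d P a b) Filter.atTop (nhds (length d P a b)) := by
  rw [hP.length_eq_variation hd]
  exact tendsto_gridSum_variation hd hP

end Semi

/-!
The proof replaces rays by sequences and follows the usual route to the stability of
quasi-geodesics in hyperbolic spaces, with extra care for the directions of all distances.

*Geometry of thin triangles.* By (B1) and (B2), if `d x y` is at most `r` and `d y x` is finite, then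
`d y x` is bounded in terms of `r`. This is what replaces symmetry. The bounds in (B1) and (B2) can
be taken to be linear in the radius (`ThinSpace.exists_linear`), because otherwise many far apart
points on one side of a triangle would be close to the same short segment of another side.
Moreover, each point on the long side of a transitive triangle `p → r → q` is close, in both
directions, to points on the two other sides (`ThinSpace.exists_near_btw_both`). By bisection, a
geodesic between the end points of a path of length `n` is within distance `O(log n)` of the path
(`ThinRel.exists_segment`).

*Stability.* If all points of a geodesic between two points of a quasi-geodesic are within `E` of the
quasi-geodesic, then they are even within `O(log E)` (`IsDQG.close_of_close`), hence within a
constant (`ThinSpace.exists_morse`); conversely, the quasi-geodesic stays within a constant after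
the geodesic (`ThinSpace.exists_btw_near`).

*Transitivity.* Let `R₁ ≤ R₂ ≤ R₃`, where `R₂` is a ray; the case of an anti-ray follows by reversing
all distances. Two short paths from `R₁` to `R₂`, one of them much farther out, span a quadrilateral
with two long sides along `R₁` and `R₂`. Thin triangles and stability show that each point of `R₂`
between them is reached from `R₁` within a bounded distance
(`IsDQG.eventually_exists_near`, `IsDQG.eventually_exists_near_of_flip`). So the far short paths
from `R₂` to `R₃` extend to paths of bounded length from `R₁` to `R₃`. As quasi-geodesics leave all
balls, out-balls as well as in-balls, all of this happens far out. The same fact gives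
reflexivity, witnessed by constant paths.

*Discretization.* A quasi-geodesic ray is replaced by a sequence of points on it whose consecutive
distances are one, and `RayLE` by the corresponding relation `SeqLE` (`RayLE.seqLE`,
`SeqLE.rayLE`).
-/

namespace Semi

variable {X : Type*} {d : X → X → ℝ≥0∞} {δ C K r s t L : ℝ} {f : ℝ → ℝ} {g : ℝ → X}
  {p q u v w x y z : X}

/-! ### Bounded distances, parametrized geodesics and betweenness -/

/-- The distance from `x` to `y` is finite and at most the real number `r`. -/
def Near (d : X → X → ℝ≥0∞) (r : ℝ) (x y : X) : Prop := d x y ≠ ⊤ ∧ (d x y).toReal ≤ r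

/-- `g` parametrizes a geodesic from `x` to `y` by arc length on `[0, L]`. -/
structure Geo (d : X → X → ℝ≥0∞) (g : ℝ → X) (L : ℝ) (x y : X) : Prop where
  nonneg : 0 ≤ L
  left : g 0 = x
  right : g L = y
  dist_eq : ∀ s t, 0 ≤ s → s ≤ t → t ≤ L → d (g s) (g t) = ENNReal.ofReal (t - s)

/-- `w` lies on a geodesic from `x` to `y`, expressed through distances only. -/
def Btw (d : X → X → ℝ≥0∞) (x w y : X) : Prop := d x y ≠ ⊤ ∧ d x w + d w y = d x y

/-- A geodesic semimetric space with `δ`-thin triangles in which two points of an out-ball or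
in-ball of radius `r` have distance `∞` or at most `f r`. Geodesics are parametrized by arc
length. -/
structure ThinSpace (d : X → X → ℝ≥0∞) (δ : ℝ) (f : ℝ → ℝ) : Prop where
  delta_nonneg : 0 ≤ δ
  semi : IsSemimetric d
  exists_geo : ∀ x y, d x y ≠ ⊤ → ∃ g L, Geo d g L x y
  thin : ∀ {x y z g L g₁ L₁ g₂ L₂}, Geo d g L x y → (Geo d g₁ L₁ x z ∨ Geo d g₁ L₁ z x) →
    (Geo d g₂ L₂ y z ∨ Geo d g₂ L₂ z y) → ∀ t, 0 ≤ t → t ≤ L →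
    (∃ s, 0 ≤ s ∧ s ≤ L₁ ∧ Near d δ (g₁ s) (g t)) ∨ ∃ s, 0 ≤ s ∧ s ≤ L₂ ∧ Near d δ (g t) (g₂ s)
  out : ∀ {x y z r}, Near d r x y → Near d r x z → d y z ≠ ⊤ → Near d (f r) y z
  inn : ∀ {x y z r}, Near d r y x → Near d r z x → d y z ≠ ⊤ → Near d (f r) y z

theorem Near.nonneg (h : Near d r x y) : 0 ≤ r := ENNReal.toReal_nonneg.trans h.2

theorem Near.mono (h : Near d r x y) (hrs : r ≤ s) : Near d s x y := ⟨h.1, h.2.trans hrs⟩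

theorem Near.of_fin (h : d x y ≠ ⊤) : Near d (d x y).toReal x y := ⟨h, le_rfl⟩

theorem near_iff (hr : 0 ≤ r) : Near d r x y ↔ d x y ≤ ENNReal.ofReal r := by
  constructor
  · rintro ⟨h1, h2⟩
    exact (ENNReal.le_ofReal_iff_toReal_le h1 hr).2 h2
  · intro h
    have h1 := (h.trans_lt ENNReal.ofReal_lt_top).ne
    exact ⟨h1, (ENNReal.le_ofReal_iff_toReal_le h1 hr).1 h⟩

theorem Near.refl (hd : IsSemimetric d) (x : X) : Near d 0 x x := by
  have : d x x = 0 := (hd.eq_zero_iff x x).2 rfl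
  simp [Near, this]

theorem IsSemimetric.fin_trans (hd : IsSemimetric d) (h1 : d x y ≠ ⊤) (h2 : d y z ≠ ⊤) :
    d x z ≠ ⊤ :=
  ((hd.triangle x z y).trans_lt (ENNReal.add_lt_top.2 ⟨h1.lt_top, h2.lt_top⟩)).ne

theorem Near.trans (hd : IsSemimetric d) (h1 : Near d r x y) (h2 : Near d s y z) :
    Near d (r + s) x z := by
  refine ⟨hd.fin_trans h1.1 h2.1, ?_⟩
  have := ENNReal.toReal_mono (ENNReal.add_lt_top.2 ⟨h1.1.lt_top, h2.1.lt_top⟩).ne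
    (hd.triangle x z y)
  rw [ENNReal.toReal_add h1.1 h2.1] at this
  linarith [h1.2, h2.2]

theorem Geo.near (h : Geo d g L x y) (hs : 0 ≤ s) (hst : s ≤ t) (ht : t ≤ L) :
    Near d (t - s) (g s) (g t) :=
  (near_iff (by linarith)).2 (h.dist_eq s t hs hst ht).le

theorem Geo.le_of_near (h : Geo d g L x y) (hs : 0 ≤ s) (ht : t ≤ L)
    (hn : Near d r (g s) (g t)) : t - s ≤ r := by
  rcases le_total s t with hst | hst
  · have := hn.2
    rwa [h.dist_eq s t hs hst ht, ENNReal.toReal_ofReal (by linarith)] at this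
  · linarith [hn.nonneg]

theorem Geo.fin (h : Geo d g L x y) (hs : 0 ≤ s) (hst : s ≤ t) (ht : t ≤ L) :
    d (g s) (g t) ≠ ⊤ := (h.near hs hst ht).1

theorem Geo.near_ends (h : Geo d g L x y) : Near d L x y := by
  have := h.near le_rfl h.nonneg le_rfl
  rwa [h.left, h.right, sub_zero] at this

theorem Geo.le_of_near_ends (h : Geo d g L x y) (hn : Near d r x y) : L ≤ r := by
  rw [← h.left, ← h.right] at hn
  simpa using h.le_of_near le_rfl le_rfl hn

theorem Geo.near_left (h : Geo d g L x y) (ht0 : 0 ≤ t) (ht : t ≤ L) : Near d t x (g t) := by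
  have := h.near le_rfl ht0 ht
  rwa [h.left, sub_zero] at this

theorem Geo.near_right (h : Geo d g L x y) (ht0 : 0 ≤ t) (ht : t ≤ L) :
    Near d (L - t) (g t) y := by
  have := h.near ht0 ht le_rfl
  rwa [h.right] at this

theorem Geo.drop (h : Geo d g L x y) (ht0 : 0 ≤ t) (ht : t ≤ L) :
    Geo d (fun a => g (t + a)) (L - t) (g t) y where
  nonneg := by linarith
  left := by simp
  right := by simp [h.right]
  dist_eq a b ha hab hb := by
    rw [h.dist_eq _ _ (by linarith) (by linarith) (by linarith)]
    congr 1; ring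

theorem Geo.btw (h : Geo d g L x y) (hr : 0 ≤ r) (hrs : r ≤ s) (hst : s ≤ t) (ht : t ≤ L) :
    Btw d (g r) (g s) (g t) := by
  refine ⟨h.fin hr (hrs.trans hst) ht, ?_⟩
  rw [h.dist_eq _ _ hr hrs (hst.trans ht), h.dist_eq _ _ (hr.trans hrs) hst ht,
    h.dist_eq _ _ hr (hrs.trans hst) ht, ← ENNReal.ofReal_add (by linarith) (by linarith)]
  congr 1; ring

theorem Geo.btw_ends (h : Geo d g L x y) (ht0 : 0 ≤ t) (ht : t ≤ L) : Btw d x (g t) y := by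
  have := h.btw le_rfl ht0 ht le_rfl
  rwa [h.left, h.right] at this

/-- Reversing a geodesic gives a geodesic for the reversed semimetric. -/
theorem Geo.flip (h : Geo d g L x y) : Geo (fun a b => d b a) (fun t => g (L - t)) L y x where
  nonneg := h.nonneg
  left := by simp [h.right]
  right := by simp [h.left]
  dist_eq s t hs hst ht := by
    rw [h.dist_eq _ _ (by linarith) (by linarith) (by linarith)]
    congr 1; ring

theorem Btw.fin_left (h : Btw d x w y) : d x w ≠ ⊤ := by
  intro h'
  have := h.2
  rw [h', top_add] at this
  exact h.1 this.symm

theorem Btw.fin_right (h : Btw d x w y) : d w y ≠ ⊤ := by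
  intro h'
  have := h.2
  rw [h', add_top] at this
  exact h.1 this.symm

theorem Btw.near_left (h : Btw d x w y) (hn : Near d r x y) : Near d r x w := by
  refine ⟨h.fin_left, (ENNReal.toReal_mono h.1 ?_).trans hn.2⟩
  rw [← h.2]; exact le_self_add

theorem Btw.near_right (h : Btw d x w y) (hn : Near d r x y) : Near d r w y := by
  refine ⟨h.fin_right, (ENNReal.toReal_mono h.1 ?_).trans hn.2⟩
  rw [← h.2]; exact le_add_self

theorem Btw.flip (h : Btw d x w y) : Btw (fun a b => d b a) y w x :=
  ⟨h.1, by rw [add_comm]; exact h.2⟩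

/-- A `1`-Lipschitz path on `[0, L]` whose end points have distance `L` is a geodesic. -/
theorem Geo.of_le (hd : IsSemimetric d) (hL : 0 ≤ L) (h0 : g 0 = x) (h1 : g L = y)
    (hle : ∀ s t, 0 ≤ s → s ≤ t → t ≤ L → Near d (t - s) (g s) (g t))
    (hxy : L ≤ (d x y).toReal) : Geo d g L x y where
  nonneg := hL
  left := h0
  right := h1
  dist_eq s t hs hst ht := by
    have n1 := hle 0 s le_rfl hs (hst.trans ht)
    have n2 := hle s t hs hst ht
    have n3 := hle t L (hs.trans hst) ht le_rfl
    have n2' : Near d (d (g s) (g t)).toReal (g s) (g t) := Near.of_fin n2.1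
    have h := ((n1.trans hd n2').trans hd n3).2
    rw [h0, h1] at h
    have : (d (g s) (g t)).toReal = t - s := le_antisymm n2.2 (by linarith)
    rw [← this, ENNReal.ofReal_toReal n2.1]

namespace ThinSpace

theorem flip (h : ThinSpace d δ f) : ThinSpace (fun x y => d y x) δ f where
  delta_nonneg := h.delta_nonneg
  semi := h.semi.flip
  exists_geo x y hxy := by
    obtain ⟨g, L, hg⟩ := h.exists_geo y x hxy
    exact ⟨_, L, hg.flip⟩
  thin := by
    intro x y z g L g₁ L₁ g₂ L₂ hg h₁ h₂ t ht0 ht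
    have k₁ := h₁.symm.imp Geo.flip Geo.flip
    have k₂ := h₂.symm.imp Geo.flip Geo.flip
    rcases h.thin hg.flip k₂ k₁ (L - t) (by linarith) (by linarith) with
      ⟨s, hs0, hs, hn⟩ | ⟨s, hs0, hs, hn⟩
    · refine Or.inr ⟨L₂ - s, by linarith, by linarith, ?_⟩
      rw [sub_sub_cancel] at hn
      exact hn
    · refine Or.inl ⟨L₁ - s, by linarith, by linarith, ?_⟩
      rw [sub_sub_cancel] at hn
      exact hn
  out h1 h2 h3 := h.inn h2 h1 h3
  inn h1 h2 h3 := h.out h2 h1 h3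

/-- A point between `x` and `y` lies on a geodesic from `x` to `y`. -/
theorem exists_geo_of_btw (h : ThinSpace d δ f) (hw : Btw d x w y) :
    ∃ g L t, Geo d g L x y ∧ 0 ≤ t ∧ t ≤ L ∧ g t = w := by
  obtain ⟨g₁, L₁, h₁⟩ := h.exists_geo x w hw.fin_left
  obtain ⟨g₂, L₂, h₂⟩ := h.exists_geo w y hw.fin_right
  have hL1 := h₁.nonneg
  have hL2 := h₂.nonneg
  refine ⟨fun t => if t ≤ L₁ then g₁ t else g₂ (t - L₁), L₁ + L₂, L₁, ?_, hL1, by linarith,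
    by simp [h₁.right]⟩
  refine Geo.of_le h.semi (by linarith) (by simp [hL1, h₁.left]) ?_ ?_ ?_
  · split_ifs with hle
    · have : L₂ = 0 := by linarith
      subst this
      rw [add_zero, h₁.right, ← h₂.left, h₂.right]
    · rw [add_sub_cancel_left, h₂.right]
  · intro s t hs hst ht
    split_ifs with hs1 ht1 ht1
    · exact h₁.near hs hst ht1
    · have n1 := h₁.near hs hs1 le_rfl
      have n2 := h₂.near le_rfl (t := t - L₁) (by linarith) (by linarith)
      rw [h₁.right] at n1
      rw [h₂.left] at n2
      exact (n1.trans h.semi n2).mono (by linarith)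
    · linarith
    · exact (h₂.near (by linarith) (by linarith) (by linarith)).mono (by linarith)
  · have e1 := h₁.dist_eq 0 L₁ le_rfl hL1 le_rfl
    have e2 := h₂.dist_eq 0 L₂ le_rfl hL2 le_rfl
    rw [h₁.left, h₁.right, sub_zero] at e1
    rw [h₂.left, h₂.right, sub_zero] at e2
    rw [← hw.2, e1, e2, ← ENNReal.ofReal_add hL1 hL2, ENNReal.toReal_ofReal (by linarith)]

/-- Thin triangles in terms of betweenness. The side `a a'` joins `p` and `r`, the side `b b'` joins
`q` and `r`, each in one of the two directions. -/
theorem thin_btw (h : ThinSpace d δ f) {r a a' b b' : X} (hx : Btw d p x q)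
    (ha : a = p ∧ a' = r ∨ a = r ∧ a' = p) (haf : d a a' ≠ ⊤)
    (hb : b = q ∧ b' = r ∨ b = r ∧ b' = q) (hbf : d b b' ≠ ⊤) :
    (∃ u, Btw d a u a' ∧ Near d δ u x) ∨ ∃ u, Btw d b u b' ∧ Near d δ x u := by
  obtain ⟨g, L, t, hg, ht0, ht, rfl⟩ := h.exists_geo_of_btw hx
  obtain ⟨g₁, L₁, h₁⟩ := h.exists_geo a a' haf
  obtain ⟨g₂, L₂, h₂⟩ := h.exists_geo b b' hbf
  have k₁ : Geo d g₁ L₁ p r ∨ Geo d g₁ L₁ r p := by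
    rcases ha with ⟨rfl, rfl⟩ | ⟨rfl, rfl⟩
    exacts [Or.inl h₁, Or.inr h₁]
  have k₂ : Geo d g₂ L₂ q r ∨ Geo d g₂ L₂ r q := by
    rcases hb with ⟨rfl, rfl⟩ | ⟨rfl, rfl⟩
    exacts [Or.inl h₂, Or.inr h₂]
  rcases h.thin hg k₁ k₂ t ht0 ht with ⟨s, hs0, hs, hn⟩ | ⟨s, hs0, hs, hn⟩
  · exact Or.inl ⟨_, h₁.btw_ends hs0 hs, hn⟩
  · exact Or.inr ⟨_, h₂.btw_ends hs0 hs, hn⟩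

/-- The bounds on distances in out-balls can be taken to be linear in the radius: the points at
distance `E, 2E, …` from `y` on a geodesic from `y` to `z` are `δ`-close to points of the two
geodesics from `x`, of length at most `r`, and points close to the same segment of length one
coincide. -/
theorem exists_linear_out (h : ThinSpace d δ f) : ∃ C : ℝ, 1 ≤ C ∧
    ∀ {x y z r}, Near d r x y → Near d r x z → d y z ≠ ⊤ → Near d (C * (r + 1)) y z := by
  set E : ℝ := |f (1 + δ)| + 1 with hE
  have hE0 : 1 ≤ E := by rw [hE]; linarith [abs_nonneg (f (1 + δ))]
  have hfE : f (1 + δ) < E := by rw [hE]; linarith [le_abs_self (f (1 + δ))]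
  have hδ := h.delta_nonneg
  refine ⟨2 * E, by linarith, ?_⟩
  intro x y z r hxy hxz hyz
  obtain ⟨g, L, hg⟩ := h.exists_geo y z hyz
  obtain ⟨g₁, L₁, h₁⟩ := h.exists_geo x y hxy.1
  obtain ⟨g₂, L₂, h₂⟩ := h.exists_geo x z hxz.1
  have hL₁ := h₁.le_of_near_ends hxy
  have hL₂ := h₂.le_of_near_ends hxz
  have hr := hxy.nonneg
  set n := ⌊L / E⌋₊ with hn
  have hnL : ∀ i ∈ Finset.range (n + 1), (i : ℝ) * E ≤ L := by
    intro i hi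
    have h1 : (i : ℝ) ≤ n := by exact_mod_cast Nat.lt_succ_iff.1 (Finset.mem_range.1 hi)
    have h2 : (n : ℝ) ≤ L / E := Nat.floor_le (by have := hg.nonneg; positivity)
    rw [le_div_iff₀ (by linarith)] at h2
    nlinarith
  -- the pigeonhole `c i` of `g (i * E)` says which side it is close to, and to which unit segment
  have key : ∀ i : ℕ, ∃ c : Bool × ℕ, i ∈ Finset.range (n + 1) →
      c.2 ∈ Finset.range (⌊r⌋₊ + 1) ∧
      (c.1 = true → ∃ s, 0 ≤ s ∧ s ≤ L₁ ∧ ⌊s⌋₊ = c.2 ∧ Near d δ (g₁ s) (g (i * E))) ∧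
      (c.1 = false → ∃ s, 0 ≤ s ∧ s ≤ L₂ ∧ ⌊s⌋₊ = c.2 ∧ Near d δ (g (i * E)) (g₂ s)) := by
    intro i
    by_cases hi : i ∈ Finset.range (n + 1)
    · rcases h.thin hg (Or.inr h₁) (Or.inr h₂) (i * E) (by positivity) (hnL i hi) with
        ⟨s, hs0, hs, hns⟩ | ⟨s, hs0, hs, hns⟩
      · refine ⟨(true, ⌊s⌋₊), fun _ => ⟨?_, fun _ => ⟨s, hs0, hs, rfl, hns⟩, by simp⟩⟩
        exact Finset.mem_range.2 (Nat.lt_succ_iff.2 (Nat.floor_mono (hs.trans hL₁)))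
      · refine ⟨(false, ⌊s⌋₊), fun _ => ⟨?_, by simp, fun _ => ⟨s, hs0, hs, rfl, hns⟩⟩⟩
        exact Finset.mem_range.2 (Nat.lt_succ_iff.2 (Nat.floor_mono (hs.trans hL₂)))
    · exact ⟨(true, 0), fun h => absurd h hi⟩
  choose c hc using key
  have floor_close : ∀ {s s' : ℝ} {k : ℕ}, 0 ≤ s → 0 ≤ s' → ⌊s⌋₊ = k → ⌊s'⌋₊ = k →
      s' - s ≤ 1 := by
    intro s s' k hs hs' hk hk'
    have a1 := Nat.lt_floor_add_one s'
    have a2 := Nat.floor_le hs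
    rw [hk'] at a1
    rw [hk] at a2
    linarith
  have inj : ∀ i ∈ Finset.range (n + 1), ∀ j ∈ Finset.range (n + 1), c i = c j → ¬ i < j := by
    intro i hi j hj hij hlt
    have hjE : (i : ℝ) * E ≤ j * E := by
      have : (i : ℝ) ≤ j := by exact_mod_cast hlt.le
      nlinarith
    have hfin : d (g (i * E)) (g (j * E)) ≠ ⊤ := hg.fin (by positivity) hjE (hnL j hj)
    suffices Near d (f (1 + δ)) (g (i * E)) (g (j * E)) by
      have h1 := hg.le_of_near (by positivity) (hnL j hj) this
      have : (i : ℝ) + 1 ≤ j := by exact_mod_cast hlt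
      nlinarith
    obtain ⟨-, hi1, hi2⟩ := hc i hi
    obtain ⟨-, hj1, hj2⟩ := hc j hj
    cases hb : (c i).1 with
    | true =>
      obtain ⟨s, hs0, hs, hsk, hsn⟩ := hi1 hb
      obtain ⟨s', hs0', hs', hsk', hsn'⟩ := hj1 (by rw [← hij]; exact hb)
      rw [← hij] at hsk'
      rcases le_total s s' with hss | hss
      · have := (h₁.near hs0 hss hs').mono (floor_close hs0 hs0' hsk hsk')
        exact h.out (hsn.mono (by linarith)) (this.trans h.semi hsn') hfin
      · have := (h₁.near hs0' hss hs).mono (floor_close hs0' hs0 hsk' hsk)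
        exact h.out (this.trans h.semi hsn) (hsn'.mono (by linarith)) hfin
    | false =>
      obtain ⟨s, hs0, hs, hsk, hsn⟩ := hi2 hb
      obtain ⟨s', hs0', hs', hsk', hsn'⟩ := hj2 (by rw [← hij]; exact hb)
      rw [← hij] at hsk'
      rcases le_total s s' with hss | hss
      · have := (h₂.near hs0 hss hs').mono (floor_close hs0 hs0' hsk hsk')
        exact h.inn ((hsn.trans h.semi this).mono (by linarith)) (hsn'.mono (by linarith)) hfin
      · have := (h₂.near hs0' hss hs).mono (floor_close hs0' hs0 hsk' hsk)
        exact h.inn (hsn.mono (by linarith)) ((hsn'.trans h.semi this).mono (by linarith)) hfin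
  have hcard : (Finset.range (n + 1)).card ≤
      ((Finset.univ : Finset Bool) ×ˢ Finset.range (⌊r⌋₊ + 1)).card := by
    refine Finset.card_le_card_of_injOn c ?_ ?_
    · intro i hi
      exact Finset.mem_product.2 ⟨Finset.mem_univ _, (hc i hi).1⟩
    · intro i hi j hj hij
      have h1 := inj i hi j hj hij
      have h2 := inj j hj i hi hij.symm
      omega
  rw [Finset.card_product, Finset.card_range, Finset.card_range, Finset.card_univ,
    Fintype.card_bool] at hcard
  refine hg.near_ends.mono ?_
  have a1 : L / E < n + 1 := Nat.lt_floor_add_one _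
  have a2 : ((n + 1 : ℕ) : ℝ) ≤ ((2 * (⌊r⌋₊ + 1) : ℕ) : ℝ) := by exact_mod_cast hcard
  have a3 : (⌊r⌋₊ : ℝ) ≤ r := Nat.floor_le hr
  push_cast at a2
  rw [div_lt_iff₀ (by linarith)] at a1
  nlinarith

theorem exists_linear (h : ThinSpace d δ f) :
    ∃ C : ℝ, 1 ≤ C ∧ ThinSpace d δ fun r => C * (r + 1) := by
  obtain ⟨C₁, hC₁, h₁⟩ := h.exists_linear_out
  obtain ⟨C₂, hC₂, h₂⟩ := h.flip.exists_linear_out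
  refine ⟨max C₁ C₂, hC₁.trans (le_max_left _ _), { h with out := ?_, inn := ?_ }⟩
  · intro x y z r a b c
    refine (h₁ a b c).mono ?_
    have := a.nonneg
    gcongr
    exact le_max_left _ _
  · intro x y z r a b c
    have key : Near (fun x y => d y x) (C₂ * (r + 1)) z y := h₂ b a c
    refine Near.mono (d := d) (r := C₂ * (r + 1)) key ?_
    have := a.nonneg
    gcongr
    exact le_max_right _ _

end ThinSpace

/-! ### The long side of a transitive triangle -/

theorem exists_near_sSup {T : Set ℝ} (hT : T.Nonempty) (hb : BddAbove T) :
    ∃ t ∈ T, ∀ t' ∈ T, t' < t + 1 := by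
  obtain ⟨t, ht, hlt⟩ := exists_lt_of_lt_csSup hT (show sSup T - 1 < sSup T by linarith)
  exact ⟨t, ht, fun t' ht' => by linarith [le_csSup hb ht']⟩

namespace ThinSpace

/-- Every point on the long side of a transitive triangle `p → r → q` is reached within a bounded
distance from the two other sides. Thinness gives this directly only up to the last point `x*` of
the long side that is close to a point after it on the side from `p`. Beyond `x*`, the sides from
`x*` to `q` and from a point `b` to `q`, where `b` is close to `x*`, are close to each other in both
directions. -/
theorem exists_near_of_btw (h : ThinSpace d δ f) : ∃ K : ℝ, 0 ≤ K ∧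
    ∀ {p q r x}, d p r ≠ ⊤ → d r q ≠ ⊤ → Btw d p x q →
      ∃ y, (Btw d p y r ∨ Btw d r y q) ∧ Near d K y x := by
  have hδ := h.delta_nonneg
  set F₁ := |f (2 * δ)| with hF₁
  set F₂ := |f (1 + 2 * δ)| with hF₂
  have hF₁0 : 0 ≤ F₁ := abs_nonneg _
  have hF₂0 : 0 ≤ F₂ := abs_nonneg _
  set D₂ := 2 * δ + 1 with hD₂
  set D₁ := D₂ + F₂ + 2 * δ + 3 with hD₁
  refine ⟨δ + D₁ + F₁, by linarith, ?_⟩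
  intro p q r x hpr hrq hx
  obtain ⟨g, L, s, hg, hs0, hs, rfl⟩ := h.exists_geo_of_btw hx
  obtain ⟨gA, LA, hA⟩ := h.exists_geo p r hpr
  obtain ⟨gB, LB, hB⟩ := h.exists_geo r q hrq
  obtain ⟨t, ⟨ht0, hts, u, hu0, hu, hut⟩, htmax⟩ := exists_near_sSup
    (T := {t | 0 ≤ t ∧ t ≤ s ∧ ∃ u, 0 ≤ u ∧ u ≤ LA ∧ Near d δ (gA u) (g t)})
    ⟨0, le_rfl, hs0, 0, le_rfl, hA.nonneg, by
      rw [hA.left, hg.left]; exact (Near.refl h.semi p).mono hδ⟩ ⟨s, fun t ht => ht.2.1⟩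
  by_cases hclose : s - t ≤ D₁
  · exact ⟨gA u, Or.inl (hA.btw_ends hu0 hu),
      (hut.trans h.semi (hg.near ht0 hts hs)).mono (by linarith)⟩
  push Not at hclose
  obtain ⟨v, hv0, hv, hbv⟩ : ∃ v, 0 ≤ v ∧ v ≤ LB ∧ Near d δ (g (t + 1)) (gB v) := by
    rcases h.thin hg (Or.inl hA) (Or.inr hB) (t + 1) (by linarith) (by linarith) with
      ⟨u', hu0', hu', hn⟩ | h'
    · exact absurd (htmax (t + 1) ⟨by linarith, by linarith, u', hu0', hu', hn⟩) (lt_irrefl _)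
    · exact h'
  have htb : Near d (1 + δ) (g t) (gB v) :=
    ((hg.near ht0 (t := t + 1) (by linarith) (by linarith)).trans h.semi hbv).mono (by linarith)
  obtain ⟨gS, LS, hS⟩ := h.exists_geo _ _ htb.1
  have hLS := hS.le_of_near_ends htb
  have hGt := hg.drop ht0 (hts.trans hs)
  have hBv := hB.drop hv0 hv
  -- `g (s - D₂)` lies between `x* = g t` and `x = g s`
  have hm : t + (s - D₂ - t) = s - D₂ := by ring
  rcases h.thin hGt (Or.inl hS) (Or.inr hBv) (s - D₂ - t) (by linarith) (by linarith) with
    ⟨σ, hσ0, hσ, hn⟩ | ⟨σ, hσ0, hσ, hn⟩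
  · rw [hm] at hn
    have := ((hS.near_left hσ0 hσ).mono (hσ.trans hLS)).trans h.semi hn
    have := hg.le_of_near ht0 (by linarith) this
    linarith
  rw [hm] at hn
  rcases h.thin hBv (Or.inr hS) (Or.inr hGt) σ hσ0 hσ with
    ⟨τ, hτ0, hτ, hn'⟩ | ⟨τ, hτ0, hτ, hn'⟩
  · have h1 := ((hS.near_left hτ0 hτ).mono (hτ.trans hLS)).trans h.semi hn'
    have h2 := h.inn (r := 1 + 2 * δ) (h1.mono (by linarith)) (hn.mono (by linarith))
      (hg.fin ht0 (by linarith) (by linarith))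
    have h3 := hg.le_of_near ht0 (by linarith) h2
    linarith [le_abs_self (f (1 + 2 * δ))]
  · have hxg : Near d (2 * δ) (g (s - D₂)) (g (t + τ)) := (hn.trans h.semi hn').mono (by linarith)
    refine ⟨gB (v + σ), Or.inr (hB.btw_ends (by linarith) (by linarith)), ?_⟩
    rcases le_total (t + τ) s with hle | hle
    · refine (hn'.trans h.semi (hg.near (by linarith) hle hs)).mono ?_
      rcases le_total (s - D₂) (t + τ) with hle' | hle'
      · linarith
      · have h1 := h.out hxg ((Near.refl h.semi _).mono (by linarith))
          (hg.fin (by linarith) hle' (by linarith))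
        have h2 := hg.le_of_near (by linarith) (by linarith) h1
        linarith [le_abs_self (f (2 * δ))]
    · have h1 := hg.le_of_near (by linarith) (by linarith) hxg
      linarith

theorem exists_near_btw_both (h : ThinSpace d δ f) : ∃ K : ℝ, 0 ≤ K ∧
    (∀ {p q r x}, d p r ≠ ⊤ → d r q ≠ ⊤ → Btw d p x q →
      ∃ y, (Btw d p y r ∨ Btw d r y q) ∧ Near d K y x) ∧
    (∀ {p q r x}, d p r ≠ ⊤ → d r q ≠ ⊤ → Btw d p x q →
      ∃ y, (Btw d p y r ∨ Btw d r y q) ∧ Near d K x y) := by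
  obtain ⟨K₁, h₁0, h₁⟩ := h.exists_near_of_btw
  obtain ⟨K₂, h₂0, h₂⟩ := h.flip.exists_near_of_btw
  refine ⟨max K₁ K₂, h₁0.trans (le_max_left _ _), ?_, ?_⟩
  · intro p q r x hpr hrq hx
    obtain ⟨y, hy, hn⟩ := h₁ hpr hrq hx
    exact ⟨y, hy, hn.mono (le_max_left _ _)⟩
  · intro p q r x hpr hrq hx
    obtain ⟨y, hy, hn⟩ := h₂ hrq hpr hx.flip
    exact ⟨y, (hy.imp Btw.flip Btw.flip).symm,
      Near.mono (d := d) (r := K₂) hn (le_max_right _ _)⟩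

end ThinSpace

/-! ### Geodesics between the end points of a path of bounded length -/

/-- A relation `Rel r x y` between points that behaves like "the distance from `x` to `y` is at
most `r`", such that all points on the long side of a transitive triangle are `K`-close to the two
other sides. It is used for the two directions of the distance. -/
structure ThinRel (d : X → X → ℝ≥0∞) (Rel : ℝ → X → X → Prop) (K : ℝ) : Prop where
  refl : ∀ x, Rel 0 x x
  trans : ∀ {r s x y z}, Rel r x y → Rel s y z → Rel (r + s) x z
  mono : ∀ {r s x y}, Rel r x y → r ≤ s → Rel s x y
  nonneg : 0 ≤ K
  thin : ∀ {p q r x}, d p r ≠ ⊤ → d r q ≠ ⊤ → Btw d p x q →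
    ∃ y, (Btw d p y r ∨ Btw d r y q) ∧ Rel K y x

theorem ThinSpace.exists_thinRel (h : ThinSpace d δ f) : ∃ K : ℝ, 0 ≤ K ∧
    ThinRel d (Near d) K ∧ ThinRel d (fun r x y => Near d r y x) K := by
  obtain ⟨K, hK, h₁, h₂⟩ := h.exists_near_btw_both
  exact ⟨K, hK, ⟨Near.refl h.semi, fun h1 h2 => h1.trans h.semi h2, Near.mono, hK, h₁⟩,
    ⟨Near.refl h.semi, fun h1 h2 => (h2.trans h.semi h1).mono (add_comm _ _).le, Near.mono, hK,
      h₂⟩⟩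

theorem fin_of_steps (hd : IsSemimetric d) {u : ℕ → X} (hu : ∀ i, d (u i) (u (i + 1)) ≠ ⊤)
    {i j : ℕ} (hij : i ≤ j) : d (u i) (u j) ≠ ⊤ := by
  induction j, hij using Nat.le_induction with
  | base => exact (Near.refl hd _).1
  | succ j _ ih => exact hd.fin_trans ih (hu j)

namespace ThinRel

variable {Rel : ℝ → X → X → Prop}

/-- Bisecting a path of `2 ^ k` segments shows that the geodesics between its end points are within
distance `K * k` of the segments. -/
theorem exists_segment (h : ThinRel d Rel K) (hd : IsSemimetric d) {u : ℕ → X}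
    (hu : ∀ i, d (u i) (u (i + 1)) ≠ ⊤) (k : ℕ) :
    ∀ {i j : ℕ} {x : X}, i < j → j ≤ i + 2 ^ k → Btw d (u i) x (u j) →
      ∃ l, i ≤ l ∧ l < j ∧ ∃ w, Btw d (u l) w (u (l + 1)) ∧ Rel (K * k) w x := by
  induction k with
  | zero =>
    intro i j x hij hj hx
    obtain rfl : j = i + 1 := by simp at hj; omega
    exact ⟨i, le_rfl, hij, x, hx, by simpa using h.refl x⟩
  | succ k ih =>
    intro i j x hij hj hx
    have hK : K * k ≤ K * (k + 1 : ℕ) := by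
      have := h.nonneg
      push_cast; nlinarith
    by_cases hmj : i + 2 ^ k < j
    · have hpos : 0 < 2 ^ k := by positivity
      obtain ⟨y, hy, hyx⟩ := h.thin (fin_of_steps hd hu (i := i) (j := i + 2 ^ k) (by omega))
        (fin_of_steps hd hu hmj.le) hx
      obtain ⟨l, hl1, hl2, w, hw, hwy⟩ : ∃ l, i ≤ l ∧ l < j ∧
          ∃ w, Btw d (u l) w (u (l + 1)) ∧ Rel (K * k) w y := by
        rcases hy with hy | hy
        · obtain ⟨l, h1, h2, h3⟩ := ih (by omega) le_rfl hy
          exact ⟨l, h1, h2.trans hmj, h3⟩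
        · obtain ⟨l, h1, h2, h3⟩ := ih hmj (by rw [pow_succ] at hj; omega) hy
          exact ⟨l, by omega, h2, h3⟩
      exact ⟨l, hl1, hl2, w, hw, h.mono (h.trans hwy hyx) (by push_cast; linarith)⟩
    · obtain ⟨l, h1, h2, w, hw, hwx⟩ := ih hij (by omega) hx
      exact ⟨l, h1, h2, w, hw, h.mono hwx hK⟩

/-- `ThinRel.exists_segment` for a path from `y` to `z` that follows the sequence `u` between its
first and last segment. -/
theorem exists_segment_of_detour (h : ThinRel d Rel K) (hd : IsSemimetric d) {u : ℕ → X}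
    (hu : ∀ i, d (u i) (u (i + 1)) ≠ ⊤) {m m' k : ℕ} (hm : m ≤ m') (hk : m' - m + 2 ≤ 2 ^ k)
    (hy : d y (u m) ≠ ⊤) (hz : d (u m') z ≠ ⊤) (hx : Btw d y x z) :
    ∃ w, Rel (K * k) w x ∧ (Btw d y w (u m) ∨
      (∃ l, m ≤ l ∧ l < m' ∧ Btw d (u l) w (u (l + 1))) ∨ Btw d (u m') w z) := by
  let v : ℕ → X := fun n => if n = 0 then y else if n ≤ m' - m + 1 then u (m + (n - 1)) else z
  have v0 : v 0 = y := rfl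
  have v1 : ∀ n, n ≤ m' - m → v (n + 1) = u (m + n) := by
    intro n hn
    simp only [v]
    rw [if_neg (by omega), if_pos (by omega)]
    rfl
  have v2 : ∀ n, m' - m + 2 ≤ n → v n = z := by
    intro n hn
    simp only [v]
    rw [if_neg (by omega), if_neg (by omega)]
  have hv : ∀ n, d (v n) (v (n + 1)) ≠ ⊤ := by
    intro n
    rcases Nat.eq_zero_or_pos n with rfl | hn
    · rw [v0, v1 0 (by omega)]; exact hy
    obtain ⟨n, rfl⟩ : ∃ k, n = k + 1 := ⟨n - 1, by omega⟩
    rcases lt_trichotomy n (m' - m) with hlt | rfl | hgt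
    · rw [v1 n hlt.le, v1 (n + 1) hlt]; exact hu _
    · rw [v1 _ le_rfl, v2 _ le_rfl, show m + (m' - m) = m' by omega]; exact hz
    · rw [v2 _ (by omega), v2 _ (by omega)]; exact (Near.refl hd _).1
  rw [← v0, ← v2 (m' - m + 2) le_rfl] at hx
  obtain ⟨l, -, hl, w, hw, hwx⟩ := h.exists_segment hd hv k (by omega) (by omega) hx
  refine ⟨w, hwx, ?_⟩
  rcases Nat.eq_zero_or_pos l with rfl | hn
  · rw [v0, v1 0 (by omega)] at hw; exact Or.inl hw
  obtain ⟨l, rfl⟩ : ∃ k, l = k + 1 := ⟨l - 1, by omega⟩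
  rcases lt_or_eq_of_le (show l ≤ m' - m by omega) with hlt | rfl
  · rw [v1 l hlt.le, v1 (l + 1) hlt] at hw
    exact Or.inr (Or.inl ⟨m + l, by omega, by omega, hw⟩)
  · rw [v1 _ le_rfl, v2 _ le_rfl, show m + (m' - m) = m' by omega] at hw
    exact Or.inr (Or.inr hw)

end ThinRel

/-! ### Discrete quasi-geodesics -/

/-- An infinite sequence of points, with steps of length at most one, along which the number of
steps between two points is at most `γ` times their distance plus `c`. -/
structure IsDQG (d : X → X → ℝ≥0∞) (γ c : ℝ) (r : ℕ → X) : Prop where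
  gamma_nonneg : 0 ≤ γ
  c_nonneg : 0 ≤ c
  step : ∀ i, Near d 1 (r i) (r (i + 1))
  le : ∀ i j : ℕ, i ≤ j → (j : ℝ) - i ≤ γ * (d (r i) (r j)).toReal + c

/-- The constant for which indices of a discrete quasi-geodesic that belong to points at distance
at most `ρ` differ by at most `idxConst γ c C * (ρ + 1)`. -/
def idxConst (γ c C : ℝ) : ℝ := γ * C + c

namespace IsDQG

variable {γ c ρ : ℝ} {r : ℕ → X} {i j : ℕ}

theorem near (hr : IsDQG d γ c r) (hd : IsSemimetric d) (hij : i ≤ j) :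
    Near d ((j : ℝ) - i) (r i) (r j) := by
  induction j, hij using Nat.le_induction with
  | base => simpa using Near.refl hd (r i)
  | succ j _ ih =>
    refine (ih.trans hd (hr.step j)).mono ?_
    push_cast; linarith

theorem idxConst_nonneg (hr : IsDQG d γ c r) (hC : 1 ≤ C) : 0 ≤ idxConst γ c C := by
  have := hr.gamma_nonneg
  have := hr.c_nonneg
  unfold idxConst
  positivity

theorem le_of_near (hr : IsDQG d γ c r) (hC : 1 ≤ C) (hij : i ≤ j)
    (hn : Near d ρ (r i) (r j)) : (j : ℝ) - i ≤ idxConst γ c C * (ρ + 1) := by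
  have h1 := hr.le i j hij
  have h2 := hn.2
  have h3 := hr.gamma_nonneg
  have h4 := hr.c_nonneg
  have h5 := hn.nonneg
  have h6 : γ * (d (r i) (r j)).toReal ≤ γ * (C * (ρ + 1)) := by
    refine mul_le_mul_of_nonneg_left ?_ h3
    nlinarith
  unfold idxConst
  nlinarith

theorem abs_le_of_near (h : ThinSpace d δ fun r => C * (r + 1)) (hC : 1 ≤ C)
    (hr : IsDQG d γ c r) (hn : Near d ρ (r i) (r j)) :
    |(j : ℝ) - i| ≤ idxConst γ c C * (ρ + 1) := by
  rcases le_total i j with hij | hij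
  · have : (i : ℝ) ≤ j := by exact_mod_cast hij
    rw [abs_of_nonneg (by linarith)]
    exact hr.le_of_near hC hij hn
  · have : (j : ℝ) ≤ i := by exact_mod_cast hij
    rw [abs_of_nonpos (by linarith)]
    have h1 := h.out hn ((Near.refl h.semi _).mono hn.nonneg) (hr.near h.semi hij).1
    have h2 := hr.le j i hij
    have h3 := hr.gamma_nonneg
    have h4 := hr.c_nonneg
    have h5 := hn.nonneg
    have h6 : γ * (d (r j) (r i)).toReal ≤ γ * (C * (ρ + 1)) :=
      mul_le_mul_of_nonneg_left h1.2 h3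
    unfold idxConst
    nlinarith

end IsDQG

/-! ### Stability of quasi-geodesics -/

/-- Logarithms of linear functions are eventually smaller than linear functions. -/
theorem exists_scale {H : ℝ} (hC : 0 ≤ C) (hK : 0 ≤ K) (hH : 0 ≤ H) :
    ∃ D₀ : ℕ, ∀ D : ℕ, D₀ ≤ D → ∃ k : ℕ, H * (D + 1) ≤ 2 ^ k ∧ C * (K * k + δ + 2) ≤ D := by
  obtain ⟨q, hq⟩ := exists_nat_ge (2 * (C * K) + 1)
  have hq1 : (1 : ℝ) ≤ q := by nlinarith [mul_nonneg hC hK]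
  have hq0 : 0 < q := by exact_mod_cast (by linarith : (0 : ℝ) < q)
  have hlim : Filter.Tendsto (fun n : ℕ => H * q * ((n : ℝ) ^ 1 / 2 ^ n + (n : ℝ) ^ 0 / 2 ^ n))
      Filter.atTop (nhds (H * q * (0 + 0))) :=
    ((tendsto_pow_const_div_const_pow_of_one_lt 1 one_lt_two).add
      (tendsto_pow_const_div_const_pow_of_one_lt 0 one_lt_two)).const_mul _
  rw [add_zero, mul_zero] at hlim
  obtain ⟨n₀, hn₀⟩ := Filter.eventually_atTop.1 (hlim.eventually (gt_mem_nhds one_pos))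
  obtain ⟨D₁, hD₁⟩ := exists_nat_ge (2 * (C * (δ + 2)))
  refine ⟨max (n₀ * q) D₁, fun D hD => ⟨D / q, ?_, ?_⟩⟩
  · have h1 : n₀ ≤ D / q := (Nat.le_div_iff_mul_le hq0).2 ((le_max_left _ _).trans hD)
    have h2 := hn₀ _ h1
    have hp : (0 : ℝ) < 2 ^ (D / q) := by positivity
    rw [← add_div, mul_div_assoc', div_lt_one hp, pow_one, pow_zero] at h2
    have h3 : D + 1 ≤ q * (D / q + 1) := by
      have := Nat.lt_mul_div_succ D hq0
      omega
    have h4 : ((D + 1 : ℕ) : ℝ) ≤ ((q * (D / q + 1) : ℕ) : ℝ) := by exact_mod_cast h3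
    push_cast at h4
    calc H * (D + 1) ≤ H * (q * ((D / q : ℕ) + 1)) := by gcongr
      _ ≤ 2 ^ (D / q) := by linarith
  · have h1 : ((D / q : ℕ) : ℝ) * q ≤ D := by exact_mod_cast Nat.div_mul_le_self D q
    have h2 : (D₁ : ℝ) ≤ D := by exact_mod_cast (le_max_right _ _).trans hD
    have h3 : C * K * (D / q : ℕ) ≤ D / 2 := by
      have : (0 : ℝ) ≤ (D / q : ℕ) := by positivity
      nlinarith
    nlinarith

/-- If every point on the geodesics from `r i` to `r j` is `E`-close, in both directions, to points
of the quasi-geodesic `r`, then it is even `C (K k + δ + 2)`-close to such points, where `k` is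
logarithmic in `E`. For a point `x`, take `y` and `z` at distance `Λ E` before and after `x`. They
are `E`-close to points of `r`, which gives a path of length linear in `E` from `y` to `z`, or in
the opposite direction, and `x` is close to this path, but not to its first and last segment. -/
theorem IsDQG.close_of_close (h : ThinSpace d δ fun r => C * (r + 1)) (hC : 1 ≤ C)
    (h₁ : ThinRel d (Near d) K) (h₂ : ThinRel d (fun r x y => Near d r y x) K)
    {γ c : ℝ} {r : ℕ → X} (hr : IsDQG d γ c r) {i j k : ℕ} (hij : i ≤ j) {Γ Λ E : ℝ}
    (hΓ : Γ = idxConst γ c C) (hΛ : Λ = C * (4 + 3 * Γ)) (hE : 1 ≤ E)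
    (hκ : C * (K * k + δ + 2) ≤ E) (hk : (Γ * (2 * Λ + 9) + 2) * E ≤ 2 ^ k)
    (hclose : ∀ x, Btw d (r i) x (r j) → (∃ l, i ≤ l ∧ l ≤ j ∧ Near d E (r l) x) ∧
      ∃ l, i ≤ l ∧ l ≤ j ∧ Near d E x (r l))
    (hx : Btw d (r i) x (r j)) :
    (∃ l, i ≤ l ∧ l ≤ j ∧ Near d (C * (K * k + δ + 2)) (r l) x) ∧
      ∃ l, i ≤ l ∧ l ≤ j ∧ Near d (C * (K * k + δ + 2)) x (r l) := by
  have hd := h.semi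
  have hδ := h.delta_nonneg
  have hΓ0 : 0 ≤ Γ := hΓ ▸ hr.idxConst_nonneg hC
  set κ := K * k with hκdef
  have hκ0 : 0 ≤ κ := mul_nonneg h₁.nonneg (by positivity)
  have hκC : κ + δ + 2 ≤ C * (κ + δ + 2) := by nlinarith
  have hCE : C ≤ C * E := by nlinarith
  have hCΓ : 0 ≤ C * Γ * E := by positivity
  have hEC : E ≤ C * E := by nlinarith
  have hΛE : Λ * E = 4 * (C * E) + 3 * (C * Γ * E) := by rw [hΛ]; ring
  have hCκ : C * (κ + δ + 2) = C * κ + C * δ + 2 * C := by ring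
  have hself : ∀ {ρ : ℝ} (a : X), 0 ≤ ρ → Near d ρ a a := fun a ha => (Near.refl hd a).mono ha
  have hfin : ∀ n, d (r n) (r (n + 1)) ≠ ⊤ := fun n => (hr.step n).1
  obtain ⟨g, L, s, hg, hs0, hs, rfl⟩ := h.exists_geo_of_btw hx
  obtain ⟨a, ha0, has, hasE, μ, m, hμi, hμj, hmi, hmj, hμ, hm, hya⟩ : ∃ a, 0 ≤ a ∧ a ≤ s ∧
      s - a ≤ Λ * E ∧ ∃ μ m, i ≤ μ ∧ μ ≤ j ∧ i ≤ m ∧ m ≤ j ∧ Near d E (r μ) (g a) ∧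
        Near d E (g a) (r m) ∧ (s - a = Λ * E ∨ g a = r m ∧ m = i) := by
    rcases le_total s (Λ * E) with hle | hle
    · have : Near d E (g 0) (r i) := by rw [hg.left]; exact hself _ (by linarith)
      have : Near d E (r i) (g 0) := by rw [hg.left]; exact hself _ (by linarith)
      exact ⟨0, le_rfl, hs0, by linarith, i, i, le_rfl, hij, le_rfl, hij, by assumption,
        by assumption, Or.inr ⟨hg.left, rfl⟩⟩
    · have h0 : 0 ≤ Λ * E := by linarith
      obtain ⟨⟨μ, hμ1, hμ2, hμ⟩, m, hm1, hm2, hm⟩ :=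
        hclose _ (hg.btw_ends (t := s - Λ * E) (by linarith) (by linarith))
      exact ⟨s - Λ * E, by linarith, by linarith, by linarith, μ, m, hμ1, hμ2, hm1, hm2, hμ, hm,
        Or.inl (by ring)⟩
  obtain ⟨b, hsb, hbL, hbsE, m', ν, hm'i, hm'j, hνi, hνj, hm', hν, hzb⟩ : ∃ b, s ≤ b ∧ b ≤ L ∧
      b - s ≤ Λ * E ∧ ∃ m' ν, i ≤ m' ∧ m' ≤ j ∧ i ≤ ν ∧ ν ≤ j ∧ Near d E (r m') (g b) ∧
        Near d E (g b) (r ν) ∧ (b - s = Λ * E ∨ g b = r m' ∧ m' = j) := by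
    rcases le_total (L - s) (Λ * E) with hle | hle
    · have : Near d E (g L) (r j) := by rw [hg.right]; exact hself _ (by linarith)
      have : Near d E (r j) (g L) := by rw [hg.right]; exact hself _ (by linarith)
      exact ⟨L, hs, le_rfl, by linarith, j, j, hij, le_rfl, hij, le_rfl, by assumption,
        by assumption, Or.inr ⟨hg.right, rfl⟩⟩
    · have h0 : 0 ≤ Λ * E := by linarith
      obtain ⟨⟨μ, hμ1, hμ2, hμ⟩, m, hm1, hm2, hm⟩ :=
        hclose _ (hg.btw_ends (t := s + Λ * E) (by linarith) (by linarith))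
      exact ⟨s + Λ * E, by linarith, by linarith, by linarith, μ, m, hμ1, hμ2, hm1, hm2, hμ, hm,
        Or.inl (by ring)⟩
  -- distances between `g a`, `g s` and `g b` in the generic situation
  have contra_y : ∀ {ρ : ℝ}, s - a = Λ * E → Near d ρ (g a) (g s) → ρ < Λ * E → False := by
    intro ρ he hn hlt
    linarith [hg.le_of_near ha0 hs hn]
  have contra_z : ∀ {ρ : ℝ}, b - s = Λ * E → Near d ρ (g s) (g b) → ρ < Λ * E → False := by
    intro ρ he hn hlt
    linarith [hg.le_of_near hs0 hbL hn]
  have fin_y : d (g a) (g s) ≠ ⊤ := hg.fin ha0 has hs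
  have fin_z : d (g s) (g b) ≠ ⊤ := hg.fin hs0 hsb hbL
  -- the indices are within a linear function of `E` of each other
  have habs1 := abs_le.1 (hr.abs_le_of_near h hC (hμ.trans hd hm))
  have habs2 := abs_le.1 (hr.abs_le_of_near h hC (hm'.trans hd hν))
  have hab : Near d (2 * (Λ * E)) (g a) (g b) :=
    (hg.near ha0 (has.trans hsb) hbL).mono (by linarith)
  have habs3 := abs_le.1 (hr.abs_le_of_near h hC ((hμ.trans hd hab).trans hd hν))
  rw [← hΓ] at habs1 habs2 habs3
  have hΓE : Γ * (E + E + 1) ≤ 3 * (Γ * E) := by nlinarith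
  have hΓE' : Γ * (E + 2 * (Λ * E) + E + 1) ≤ 2 * (Γ * Λ * E) + 3 * (Γ * E) := by nlinarith
  have hk' : 2 * (Γ * Λ * E) + 9 * (Γ * E) + 2 * E ≤ 2 ^ k := by linarith
  have hΓE0 : 0 ≤ Γ * E := by positivity
  rcases le_or_gt m m' with hmm | hmm
  · have hlen : m' - m + 2 ≤ 2 ^ k := by
      have : (((m' - m + 2 : ℕ)) : ℝ) ≤ ((2 ^ k : ℕ) : ℝ) := by
        push_cast [Nat.cast_sub hmm]
        linarith [habs1.1, habs1.2, habs2.1, habs2.2, habs3.1, habs3.2]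
      exact_mod_cast this
    have hbtw := hg.btw ha0 has hsb hbL
    constructor
    · obtain ⟨w, hwx, hw | ⟨l, hl1, hl2, hw⟩ | hw⟩ :=
        h₁.exists_segment_of_detour hd hfin hmm hlen hm.1 hm'.1 hbtw
      · rcases hya with hya | ⟨hya, -⟩
        · exact (contra_y hya ((hw.near_left hm).trans hd hwx) (by linarith)).elim
        · rw [hya] at hw
          exact ⟨m, hmi, hmj, ((hw.near_left (Near.refl hd _)).trans hd hwx).mono (by linarith)⟩
      · exact ⟨l, by omega, by omega,
          ((hw.near_left (hr.step l)).trans hd hwx).mono (by linarith)⟩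
      · rcases hzb with hzb | ⟨hzb, -⟩
        · have := h.out (r := E) (hwx.mono (by linarith)) (hw.near_right hm') fin_z
          exact (contra_z hzb this (by linarith)).elim
        · rw [hzb] at hw
          exact ⟨m', hm'i, hm'j, ((hw.near_left (Near.refl hd _)).trans hd hwx).mono (by linarith)⟩
    · obtain ⟨w, hwx, hw | ⟨l, hl1, hl2, hw⟩ | hw⟩ :=
        h₂.exists_segment_of_detour hd hfin hmm hlen hm.1 hm'.1 hbtw
      · rcases hya with hya | ⟨hya, -⟩
        · have := h.inn (r := E) (hw.near_left hm) (hwx.mono (by linarith)) fin_y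
          exact (contra_y hya this (by linarith)).elim
        · rw [hya] at hw
          exact ⟨m, hmi, hmj, (Near.trans hd hwx (hw.near_right (Near.refl hd _))).mono
            (by linarith)⟩
      · exact ⟨l + 1, by omega, by omega,
          (Near.trans hd hwx (hw.near_right (hr.step l))).mono (by linarith)⟩
      · rcases hzb with hzb | ⟨hzb, -⟩
        · exact (contra_z hzb (Near.trans hd hwx (hw.near_right hm')) (by linarith)).elim
        · rw [hzb] at hw
          exact ⟨m', hm'i, hm'j, (Near.trans hd hwx (hw.near_right (Near.refl hd _))).mono
            (by linarith)⟩
  have hya' : s - a = Λ * E := by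
    rcases hya with hya | ⟨-, hya⟩
    · exact hya
    · omega
  have hzb' : b - s = Λ * E := by
    rcases hzb with hzb | ⟨-, hzb⟩
    · exact hzb
    · omega
  have hmmR : (m' : ℝ) < m := by exact_mod_cast hmm
  rcases le_or_gt μ ν with hμν | hμν
  · -- all four indices are close to each other, so that `g a` and `g b` are in a common in-ball
    have hμνR : (μ : ℝ) ≤ ν := by exact_mod_cast hμν
    have e1 : Near d (3 * (Γ * E)) (r m) (r (max m ν)) := by
      refine (hr.near hd (le_max_left _ _)).mono ?_
      rcases le_total m ν with hle | hle
      · rw [max_eq_right hle]; linarith [habs2.2]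
      · rw [max_eq_left hle]; linarith
    have e2 : Near d (3 * (Γ * E)) (r ν) (r (max m ν)) := by
      refine (hr.near hd (le_max_right _ _)).mono ?_
      rcases le_total m ν with hle | hle
      · rw [max_eq_right hle]; linarith
      · rw [max_eq_left hle]; linarith [habs1.2]
    have e3 := h.inn (hm.trans hd e1) (hν.trans hd e2) hab.1
    have e4 := hg.le_of_near ha0 hbL e3
    nlinarith
  · -- `g b` leads back to `g a`, and `g s` is close to a geodesic from `g b` to `g a`
    have fin_ν : ∀ l, ν ≤ l → d (g b) (r l) ≠ ⊤ := fun l hl =>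
      hd.fin_trans hν.1 (hr.near hd hl).1
    have fin_ba : d (g b) (g a) ≠ ⊤ := hd.fin_trans (fin_ν μ hμν.le) hμ.1
    have hlen : μ - ν + 2 ≤ 2 ^ k := by
      have : (((μ - ν + 2 : ℕ)) : ℝ) ≤ ((2 ^ k : ℕ) : ℝ) := by
        push_cast [Nat.cast_sub hμν.le]
        linarith [habs3.1]
      exact_mod_cast this
    rcases h.thin_btw (hg.btw ha0 has hsb hbL) (Or.inr ⟨rfl, rfl⟩) fin_ba (Or.inl ⟨rfl, rfl⟩)
      (Near.refl hd _).1 with ⟨u, hu, hux⟩ | ⟨u, hu, hxu⟩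
    · obtain ⟨w, hwu, hw | ⟨l, hl1, hl2, hw⟩ | hw⟩ :=
        h₁.exists_segment_of_detour hd hfin hμν.le hlen hν.1 hμ.1 hu
      · have e1 := ((hw.near_left hν).trans hd hwu).trans hd hux
        have e2 := h.out e1 (hself _ e1.nonneg) fin_z
        exact (contra_z hzb' e2 (by linarith)).elim
      · have e1 : Near d (κ + δ + 1) (r l) (g s) :=
          (((hw.near_left (hr.step l)).trans hd hwu).trans hd hux).mono (by linarith)
        have e2 := h.out e1 (hself _ e1.nonneg) (hd.fin_trans fin_z (fin_ν l hl1))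
        exact ⟨⟨l, by omega, by omega, e1.mono (by linarith)⟩, l, by omega, by omega,
          e2.mono (by linarith)⟩
      · have e0 : d (g a) w ≠ ⊤ :=
          hd.fin_trans hab.1 (hd.fin_trans (fin_ν μ hμν.le) hw.fin_left)
        have e1 := h.out (hw.near_right hμ) (hself _ (by linarith)) e0
        exact (contra_y hya' ((e1.trans hd hwu).trans hd hux) (by linarith)).elim
    · exact (contra_z hzb' (hxu.trans hd (hu.near_right (Near.refl hd _))) (by linarith)).elim

/-- Geodesics between two points of a quasi-geodesic are within a bounded distance of the
quasi-geodesic, in both directions. -/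
theorem ThinSpace.exists_morse (h : ThinSpace d δ fun r => C * (r + 1)) (hC : 1 ≤ C) {γ c : ℝ}
    (hγ : 0 ≤ γ) (hc : 0 ≤ c) :
    ∃ κ : ℝ, 0 ≤ κ ∧ ∀ r : ℕ → X, IsDQG d γ c r → ∀ {i j : ℕ}, i ≤ j →
      ∀ {x : X}, Btw d (r i) x (r j) → (∃ l, i ≤ l ∧ l ≤ j ∧ Near d κ (r l) x) ∧
        ∃ l, i ≤ l ∧ l ≤ j ∧ Near d κ x (r l) := by
  obtain ⟨K, hK, h₁, h₂⟩ := h.exists_thinRel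
  set Γ := idxConst γ c C with hΓ
  have hΓ0 : 0 ≤ Γ := by rw [hΓ]; unfold idxConst; positivity
  set Λ := C * (4 + 3 * Γ) with hΛ
  obtain ⟨D₀, hD₀⟩ := exists_scale (C := C) (K := K) (δ := δ) (H := Γ * (2 * Λ + 9) + 2)
    (by linarith) hK (by positivity)
  refine ⟨D₀, by positivity, fun r hr i j hij x hx => ?_⟩
  let P : ℕ → Prop := fun D => ∀ x, Btw d (r i) x (r j) →
    (∃ l, i ≤ l ∧ l ≤ j ∧ Near d D (r l) x) ∧ ∃ l, i ≤ l ∧ l ≤ j ∧ Near d D x (r l)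
  have hstep : ∀ D, D₀ ≤ D → P (D + 1) → P D := by
    intro D hD hP x hx
    obtain ⟨k, hk1, hk2⟩ := hD₀ D hD
    obtain ⟨⟨l, a1, a2, a3⟩, l', b1, b2, b3⟩ :=
      hr.close_of_close h hC h₁ h₂ hij hΓ hΛ (E := D + 1)
      (by have : (0 : ℝ) ≤ D := by positivity
          linarith) (hk2.trans (by linarith)) hk1 (by
        intro x hx
        have := hP x hx
        push_cast at this
        exact this) hx
    exact ⟨⟨l, a1, a2, a3.mono hk2⟩, l', b1, b2, b3.mono hk2⟩
  have hdown : ∀ e, P (D₀ + e) → P D₀ := by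
    intro e
    induction e with
    | zero => exact id
    | succ e ih => exact fun hP => ih (hstep _ (by omega) hP)
  refine hdown (j - i) ?_ x hx
  intro x hx
  have hn := hr.near h.semi hij
  have hle : (j : ℝ) - i ≤ ((D₀ + (j - i) : ℕ) : ℝ) := by
    push_cast [Nat.cast_sub hij]
    have : (0 : ℝ) ≤ D₀ := by positivity
    linarith
  exact ⟨⟨i, le_rfl, hij, (hx.near_left hn).mono hle⟩, j, hij, le_rfl, (hx.near_right hn).mono hle⟩

/-- Quasi-geodesics are within a bounded distance after the geodesics between their points. -/
theorem ThinSpace.exists_btw_near (h : ThinSpace d δ fun r => C * (r + 1)) (hC : 1 ≤ C) {γ c : ℝ}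
    (hγ : 0 ≤ γ) (hc : 0 ≤ c) :
    ∃ κ : ℝ, 0 ≤ κ ∧ ∀ r : ℕ → X, IsDQG d γ c r → ∀ {i k j : ℕ}, i ≤ k → k ≤ j →
      ∃ x, Btw d (r i) x (r j) ∧ Near d κ x (r k) := by
  obtain ⟨κ, hκ, hmorse⟩ := h.exists_morse hC hγ hc
  have hΓ0 : 0 ≤ idxConst γ c C := by unfold idxConst; positivity
  refine ⟨κ + idxConst γ c C * (C * (κ + 2) + 1), by positivity, fun r hr i k j hik hkj => ?_⟩
  have hd := h.semi
  obtain ⟨g, L, hg⟩ := h.exists_geo _ _ (hr.near hd (hik.trans hkj)).1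
  -- the last point of the geodesic that is close to a point of `r` up to `r k`
  obtain ⟨s, ⟨hs0, hsL, m, hmk, hm⟩, hmax⟩ := exists_near_sSup
    (T := {s | 0 ≤ s ∧ s ≤ L ∧ ∃ m, m ≤ k ∧ Near d κ (g s) (r m)})
    ⟨0, le_rfl, hg.nonneg, i, hik, by rw [hg.left]; exact (Near.refl hd _).mono hκ⟩
    ⟨L, fun s hs => hs.2.1⟩
  obtain ⟨m', hkm', hm'⟩ : ∃ m', k ≤ m' ∧ Near d (κ + 1) (g s) (r m') := by
    rcases le_total (s + 1) L with hle | hle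
    · obtain ⟨-, m', -, -, hm'⟩ :=
        hmorse r hr (hik.trans hkj) (hg.btw_ends (t := s + 1) (by linarith) hle)
      refine ⟨m', ?_, ((hg.near hs0 (by linarith) hle).trans hd hm').mono (by linarith)⟩
      by_contra! hlt
      exact lt_irrefl _ (hmax (s + 1) ⟨by linarith, hle, m', hlt.le, hm'⟩)
    · exact ⟨j, hkj, (hg.near_right hs0 hsL).mono (by linarith)⟩
  have h1 := h.out (hm.mono (by linarith)) hm' (hr.near hd (hmk.trans hkm')).1
  have h2 := hr.le_of_near hC (hmk.trans hkm') h1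
  have h3 : (k : ℝ) ≤ m' := by exact_mod_cast hkm'
  refine ⟨g s, hg.btw_ends hs0 hsL, (hm.trans hd (hr.near hd hmk)).mono ?_⟩
  have : C * (κ + 1 + 1) = C * (κ + 2) := by ring
  rw [this] at h2
  linarith

/-! ### The quasiorder on discrete quasi-geodesics -/

/-- The discrete version of `RayLE`: there are points of `a` and `b` arbitrarily far out such that
the distance from the first to the second is bounded. -/
def SeqLE (d : X → X → ℝ≥0∞) (a b : ℕ → X) : Prop :=
  ∃ M : ℝ, ∀ N : ℕ, ∃ i j, N ≤ i ∧ N ≤ j ∧ Near d M (a i) (b j)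

/-- A discrete quasi-geodesic ray, or a discrete quasi-geodesic anti-ray run through backwards. -/
def IsDQGEither (d : X → X → ℝ≥0∞) (a : ℕ → X) : Prop :=
  ∃ γ c, IsDQG d γ c a ∨ IsDQG (fun x y => d y x) γ c a

theorem IsDQGEither.flip {a : ℕ → X} (ha : IsDQGEither d a) :
    IsDQGEither (fun x y => d y x) a := by
  obtain ⟨γ, c, ha⟩ := ha
  exact ⟨γ, c, ha.symm⟩

theorem SeqLE.flip {a b : ℕ → X} (hab : SeqLE d a b) : SeqLE (fun x y => d y x) b a := by
  obtain ⟨M, hM⟩ := hab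
  refine ⟨M, fun N => ?_⟩
  obtain ⟨i, j, hi, hj, hn⟩ := hM N
  exact ⟨j, i, hj, hi, hn⟩

theorem eventually_not_of_bounded_diff {P : ℕ → Prop} {B : ℝ}
    (hP : ∀ i j : ℕ, i ≤ j → P i → P j → (j : ℝ) - i ≤ B) : ∀ᶠ i in Filter.atTop, ¬ P i := by
  by_cases hex : ∃ i, P i
  · obtain ⟨i, hi⟩ := hex
    obtain ⟨n, hn⟩ := exists_nat_gt B
    refine Filter.eventually_atTop.2 ⟨i + n, fun j hj hPj => ?_⟩
    have h1 := hP i j (by omega) hi hPj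
    have h2 : ((i + n : ℕ) : ℝ) ≤ j := by exact_mod_cast hj
    push_cast at h2
    linarith
  · exact Filter.Eventually.of_forall fun i hi => hex ⟨i, hi⟩

/-- A quasi-geodesic eventually leaves every out-ball and every in-ball. -/
theorem IsDQG.eventually_not_near (h : ThinSpace d δ fun r => C * (r + 1)) (hC : 1 ≤ C)
    {γ c : ℝ} {r : ℕ → X} (hr : IsDQG d γ c r) (w : X) (ρ : ℝ) :
    ∀ᶠ i in Filter.atTop, ¬ Near d ρ w (r i) ∧ ¬ Near d ρ (r i) w := by
  refine Filter.Eventually.and ?_ ?_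
  · exact eventually_not_of_bounded_diff fun i j hij hi hj =>
      hr.le_of_near hC hij (h.out hi hj (hr.near h.semi hij).1)
  · exact eventually_not_of_bounded_diff fun i j hij hi hj =>
      hr.le_of_near hC hij (h.inn hi hj (hr.near h.semi hij).1)

theorem IsDQGEither.eventually_not_near (h : ThinSpace d δ fun r => C * (r + 1)) (hC : 1 ≤ C)
    {r : ℕ → X} (hr : IsDQGEither d r) (w : X) (ρ : ℝ) :
    ∀ᶠ i in Filter.atTop, ¬ Near d ρ w (r i) ∧ ¬ Near d ρ (r i) w := by
  obtain ⟨γ, c, hr | hr⟩ := hr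
  · exact hr.eventually_not_near h hC w ρ
  · exact (hr.eventually_not_near h.flip hC w ρ).mono fun i hi => hi.symm

/-- If `a` is an anti-ray below a ray `b`, then all far points of `b` are reached from `a` within a
bounded distance. The geodesic from `b j₀` to a far point `b j'` is close to geodesics from `a i'`
to `a i₀`, where short geodesics lead from `a i₀` to `b j₀` and from `a i'` to `b j'`. -/
theorem IsDQG.eventually_exists_near_of_flip (h : ThinSpace d δ fun r => C * (r + 1)) (hC : 1 ≤ C)
    {γ c γ' c' : ℝ} {a b : ℕ → X} (ha : IsDQG (fun x y => d y x) γ' c' a) (hb : IsDQG d γ c b)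
    (hab : SeqLE d a b) : ∃ M, ∀ᶠ k in Filter.atTop, ∃ i, Near d M (a i) (b k) := by
  have hd := h.semi
  have hδ := h.delta_nonneg
  obtain ⟨κa, hκa, hmorse⟩ := h.flip.exists_morse hC ha.gamma_nonneg ha.c_nonneg
  obtain ⟨κb, hκb, hnear⟩ := h.exists_btw_near hC hb.gamma_nonneg hb.c_nonneg
  obtain ⟨M, hM⟩ := hab
  obtain ⟨i₀, j₀, -, -, h₀⟩ := hM 0
  have hM0 := h₀.nonneg
  refine ⟨κa + δ + δ + κb, ?_⟩
  filter_upwards [hb.eventually_not_near h hC (b j₀) (C * (δ + M + 1) + κb),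
    Filter.eventually_ge_atTop j₀] with k hk hj₀k
  obtain ⟨N, hN⟩ := Filter.eventually_atTop.1
    (hb.eventually_not_near h hC (b k) (C * (δ + M + κb + 1)))
  obtain ⟨i', j', hi', hj', h'⟩ := hM (max N (max i₀ k))
  have hi₀ : i₀ ≤ i' := ((le_max_left _ _).trans (le_max_right _ _)).trans hi'
  have hkj' : k ≤ j' := ((le_max_right _ _).trans (le_max_right _ _)).trans hj'
  obtain ⟨x, hx, hxk⟩ := hnear b hb hj₀k hkj'
  have haa : d (a i') (a i₀) ≠ ⊤ := (ha.near hd.flip hi₀).1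
  have hab' : d (a i') (b j₀) ≠ ⊤ := hd.fin_trans haa h₀.1
  rcases h.thin_btw hx (Or.inr ⟨rfl, rfl⟩) hab' (Or.inr ⟨rfl, rfl⟩) h'.1 with
    ⟨y, hy, hyx⟩ | ⟨u, hu, hxu⟩
  · rcases h.thin_btw hy (Or.inl ⟨rfl, rfl⟩) haa (Or.inr ⟨rfl, rfl⟩) h₀.1 with
      ⟨y', hy', hy'y⟩ | ⟨u, hu, hyu⟩
    · obtain ⟨-, l, -, -, hl⟩ := hmorse a ha hi₀ hy'.flip
      have hl : Near d κa (a l) y' := hl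
      exact ⟨l, (((hl.trans hd hy'y).trans hd hyx).trans hd hxk)⟩
    · have e1 := hyu.trans hd (hu.near_right h₀)
      have e2 := h.out e1 (hyx.mono (by linarith)) hx.fin_left
      exact absurd (e2.trans hd hxk) hk.1
  · have e1 := hxu.trans hd (hu.near_right h')
    have e2 := h.out (r := δ + M + κb) (hxk.mono (by linarith)) (e1.mono (by linarith))
      (hb.near hd hkj').1
    exact absurd e2 (hN j' ((le_max_left _ _).trans hj')).1

/-- If `a` is a ray below a ray `b`, then all far points of `b` are reached from `a` within a bounded
distance. The geodesic from `b j₀` to a far point `b j'` is close to a geodesic from `a i₀` to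
`b j'`, which is close to a geodesic from `a i₀` to `a i'`, where short geodesics lead from `a i₀`
to `b j₀` and from `a i'` to `b j'`. -/
theorem IsDQG.eventually_exists_near (h : ThinSpace d δ fun r => C * (r + 1)) (hC : 1 ≤ C)
    {γ c γ' c' : ℝ} {a b : ℕ → X} (ha : IsDQG d γ' c' a) (hb : IsDQG d γ c b)
    (hab : SeqLE d a b) : ∃ M, ∀ᶠ k in Filter.atTop, ∃ i, Near d M (a i) (b k) := by
  have hd := h.semi
  have hδ := h.delta_nonneg
  obtain ⟨κa, hκa, hmorse⟩ := h.exists_morse hC ha.gamma_nonneg ha.c_nonneg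
  obtain ⟨κb, hκb, hnear⟩ := h.exists_btw_near hC hb.gamma_nonneg hb.c_nonneg
  obtain ⟨M, hM⟩ := hab
  obtain ⟨i₀, j₀, -, -, h₀⟩ := hM 0
  have hM0 := h₀.nonneg
  have hCC : 0 ≤ C * (2 * δ + 1) := by positivity
  set B₁ := C * (M + δ + 1) with hB₁
  set B := C * (B₁ + 1) with hB
  have hB₁0 : M + δ + 1 ≤ B₁ := by rw [hB₁]; nlinarith
  have hB₁B : B₁ + 1 ≤ B := by rw [hB]; nlinarith
  refine ⟨κa + δ + (δ + (2 * δ + C * (2 * δ + 1)) + κb), ?_⟩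
  filter_upwards [hb.eventually_not_near h hC (b j₀) (B + 2 * δ + κb),
    Filter.eventually_ge_atTop j₀] with k hk hj₀k
  obtain ⟨N, hN⟩ := Filter.eventually_atTop.1
    (hb.eventually_not_near h hC (b k) (C * (2 * δ + M + κb + 1)))
  obtain ⟨i', j', hi', hj', h'⟩ := hM (max N (max i₀ k))
  have hi₀ : i₀ ≤ i' := ((le_max_left _ _).trans (le_max_right _ _)).trans hi'
  have hkj' : k ≤ j' := ((le_max_right _ _).trans (le_max_right _ _)).trans hj'
  obtain ⟨x, hx, hxk⟩ := hnear b hb hj₀k hkj'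
  have haa : d (a i₀) (a i') ≠ ⊤ := (ha.near hd hi₀).1
  have hab' : d (a i₀) (b j') ≠ ⊤ := hd.fin_trans haa h'.1
  obtain ⟨g, L, s, hg, hs0, hsL, rfl⟩ := h.exists_geo_of_btw hx
  have hsB : B < s - 2 * δ := by
    by_contra! hle
    exact hk.1 (((hg.near_left hs0 hsL).trans hd hxk).mono (by linarith))
  -- moving back from `g s` by `2 * δ` makes room for reaching a point before `g s` below
  have hs1 : 0 ≤ s - 2 * δ := by linarith
  have hfar : ∀ {ρ : ℝ}, ρ ≤ B → ¬ Near d ρ (b j₀) (g (s - 2 * δ)) := by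
    intro ρ hρ hn
    rw [← hg.left] at hn
    linarith [hg.le_of_near le_rfl (by linarith) hn]
  have hx1 := hg.btw_ends (t := s - 2 * δ) hs1 (by linarith)
  have hxk1 : Near d (2 * δ + κb) (g (s - 2 * δ)) (b k) :=
    ((hg.near hs1 (by linarith) hsL).trans hd hxk).mono (by linarith)
  rcases h.thin_btw hx1 (Or.inr ⟨rfl, rfl⟩) h₀.1 (Or.inr ⟨rfl, rfl⟩) hab' with
    ⟨u, hu, hux⟩ | ⟨q, hq, hxq⟩
  · have e1 := (hu.near_left h₀).trans hd hux
    have e2 := h.out (h₀.mono (by linarith)) e1 hx1.fin_left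
    exact absurd e2 (hfar (by linarith))
  obtain ⟨gq, Lq, σ, hgq, hσ0, hσ, rfl⟩ := h.exists_geo_of_btw hq
  obtain ⟨gS, LS, hgS⟩ := h.exists_geo _ _ h₀.1
  have hLS := hgS.le_of_near_ends h₀
  obtain ⟨τ, hτ0, hτ, hn⟩ : ∃ τ, 0 ≤ τ ∧ τ ≤ L ∧ Near d δ (gq σ) (g τ) := by
    rcases h.thin hgq (Or.inl hgS) (Or.inr hg) σ hσ0 hσ with ⟨τ, hτ0, hτ, hn⟩ | h'
    · have e1 := ((hgS.near_left hτ0 hτ).mono (hτ.trans hLS)).trans hd hn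
      have e2 := h.inn e1 (hxq.mono (by linarith)) (hd.fin_trans h₀.1 hx1.fin_left)
      have e3 := h.out (h₀.mono (by linarith)) e2 hx1.fin_left
      exact absurd e3 (hfar le_rfl)
    · exact h'
  have hxp : Near d (2 * δ) (g (s - 2 * δ)) (g τ) := (hxq.trans hd hn).mono (by linarith)
  have hτs : τ ≤ s := by linarith [hg.le_of_near hs1 hτ hxp]
  have hsτ : s - τ ≤ 2 * δ + C * (2 * δ + 1) := by
    rcases le_total τ (s - 2 * δ) with hle | hle
    · have e1 := h.out hxp ((Near.refl hd _).mono hxp.nonneg) (hg.fin hτ0 hle (by linarith))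
      linarith [hg.le_of_near hτ0 (by linarith) e1]
    · linarith
  have hqk : Near d (δ + (2 * δ + C * (2 * δ + 1)) + κb) (gq σ) (b k) :=
    (hn.trans hd ((hg.near hτ0 hτs hsL).mono hsτ)).trans hd hxk
  rcases h.thin_btw hq (Or.inl ⟨rfl, rfl⟩) haa (Or.inr ⟨rfl, rfl⟩) h'.1 with
    ⟨u, hu, huq⟩ | ⟨u, hu, hqu⟩
  · obtain ⟨⟨l, -, -, hl⟩, -⟩ := hmorse a ha hi₀ hu
    exact ⟨l, (hl.trans hd huq).trans hd hqk⟩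
  · have e1 := (hxq.trans hd hqu).trans hd (hu.near_right h')
    have e2 := h.out (r := 2 * δ + M + κb) (hxk1.mono (by linarith)) (e1.mono (by linarith))
      (hb.near hd hkj').1
    exact absurd e2 (hN j' ((le_max_left _ _).trans hj')).1

theorem SeqLE.trans_of_isDQG (h : ThinSpace d δ fun r => C * (r + 1)) (hC : 1 ≤ C) {γ c : ℝ}
    {a b e : ℕ → X} (ha : IsDQGEither d a) (hb : IsDQG d γ c b) (hab : SeqLE d a b)
    (hbe : SeqLE d b e) : SeqLE d a e := by
  obtain ⟨M, hM⟩ : ∃ M, ∀ᶠ k in Filter.atTop, ∃ i, Near d M (a i) (b k) := by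
    obtain ⟨γ', c', ha | ha⟩ := ha
    · exact ha.eventually_exists_near h hC hb hab
    · exact ha.eventually_exists_near_of_flip h hC hb hab
  obtain ⟨M', hM'⟩ := hbe
  refine ⟨M + M', fun N => ?_⟩
  -- no fixed point of `a` reaches the far points of `b` within a bounded distance
  have hN : ∀ᶠ k in Filter.atTop, ∀ i ∈ Finset.range N, ¬ Near d M (a i) (b k) :=
    (Filter.eventually_all_finset _).2 fun i _ =>
      (hb.eventually_not_near h hC (a i) M).mono fun _ hk => hk.1
  obtain ⟨k₀, hk₀⟩ := Filter.eventually_atTop.1 (hM.and hN)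
  obtain ⟨k, j, hk, hj, hkj⟩ := hM' (max k₀ N)
  obtain ⟨⟨i, hi⟩, hi'⟩ := hk₀ k ((le_max_left _ _).trans hk)
  refine ⟨i, j, ?_, (le_max_right _ _).trans hj, hi.trans h.semi hkj⟩
  by_contra! hlt
  exact hi' i (Finset.mem_range.2 hlt) hi

theorem SeqLE.trans (h : ThinSpace d δ fun r => C * (r + 1)) (hC : 1 ≤ C) {a b e : ℕ → X}
    (ha : IsDQGEither d a) (hb : IsDQGEither d b) (he : IsDQGEither d e) (hab : SeqLE d a b)
    (hbe : SeqLE d b e) : SeqLE d a e := by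
  obtain ⟨γ, c, hb | hb⟩ := hb
  · exact hab.trans_of_isDQG h hC ha hb hbe
  · exact (hbe.flip.trans_of_isDQG h.flip hC he.flip hb hab.flip).flip

theorem SeqLE.refl (hd : IsSemimetric d) (a : ℕ → X) : SeqLE d a a :=
  ⟨0, fun N => ⟨N, N, le_rfl, le_rfl, Near.refl hd _⟩⟩

/-! ### Lengths of directed paths -/

theorem IsBicontinuousOn.mono (hd : IsSemimetric d) {P : ℝ → X} {I J : Set ℝ}
    (h : IsBicontinuousOn d P I) (hJ : J ⊆ I) : IsBicontinuousOn d P J := by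
  rw [isBicontinuousOn_iff hd] at h ⊢
  refine ⟨fun s hs ε hε => ?_, fun s hs ε hε => ?_⟩
  · obtain ⟨η, hη, h'⟩ := h.1 s (hJ hs) ε hε
    exact ⟨η, hη, fun t ht => h' t (hJ ht)⟩
  · obtain ⟨η, hη, h'⟩ := h.2 s (hJ hs) ε hε
    exact ⟨η, hη, fun t ht => h' t (hJ ht)⟩

theorem IsDirectedPath.sum_le_length (hd : IsSemimetric d) {P : ℝ → X} {a b : ℝ}
    (hP : IsDirectedPath d P a b) {u : ℕ → ℝ} (hu : Monotone u) (hm : ∀ i, u i ∈ Set.Icc a b)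
    (n : ℕ) : ∑ i ∈ Finset.range n, d (P (u i)) (P (u (i + 1))) ≤ length d P a b := by
  rw [hP.length_eq_variation hd]
  exact le_iSup (fun p : ℕ × {u : ℕ → ℝ // Monotone u ∧ ∀ i, u i ∈ Set.Icc a b} =>
    ∑ i ∈ Finset.range p.1, d (P (p.2.1 i)) (P (p.2.1 (i + 1)))) ⟨n, u, hu, hm⟩

theorem IsDirectedPath.add_le_length (hd : IsSemimetric d) {P : ℝ → X} {a b s t : ℝ}
    (hP : IsDirectedPath d P a b) (has : a ≤ s) (hst : s ≤ t) (htb : t ≤ b) :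
    d (P a) (P s) + d (P s) (P t) + d (P t) (P b) ≤ length d P a b := by
  let u : ℕ → ℝ := fun n => if n = 0 then a else if n = 1 then s else if n = 2 then t else b
  have hu : Monotone u := by
    refine monotone_nat_of_le_succ fun n => ?_
    rcases n with _ | _ | _ | n <;> simp [u, has, hst, htb]
  have hm : ∀ i, u i ∈ Set.Icc a b := by
    intro n
    refine ⟨hu (Nat.zero_le n), ?_⟩
    simp only [u]
    split_ifs <;> linarith
  have := hP.sum_le_length hd hu hm 3
  simpa [Finset.sum_range_succ, u] using this

/-- The set of times at which a bicontinuous path is at finite distance from its start is closed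
under limits from the left, by backward continuity, and open to the right, by forward continuity. -/
theorem IsBicontinuousOn.fin (hd : IsSemimetric d) {P : ℝ → X} {a b : ℝ} (hab : a ≤ b)
    (h : IsBicontinuousOn d P (Set.Icc a b)) : d (P a) (P b) ≠ ⊤ := by
  obtain ⟨hf, hb⟩ := (isBicontinuousOn_iff hd P _).1 h
  set T := {t | t ∈ Set.Icc a b ∧ d (P a) (P t) ≠ ⊤} with hT
  have haT : a ∈ T := ⟨⟨le_rfl, hab⟩, (Near.refl hd _).1⟩
  have hbdd : BddAbove T := ⟨b, fun t ht => ht.1.2⟩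
  have hτ : sSup T ∈ Set.Icc a b :=
    ⟨le_csSup hbdd haT, csSup_le ⟨a, haT⟩ fun t ht => ht.1.2⟩
  have hτT : sSup T ∈ T := by
    obtain ⟨η, hη, h'⟩ := hb _ hτ 1 one_pos
    have hη' : (0 : ℝ) < η := by exact_mod_cast hη
    obtain ⟨t, ht, hlt⟩ := exists_lt_of_lt_csSup ⟨a, haT⟩ (show sSup T - η < sSup T by linarith)
    exact ⟨hτ, hd.fin_trans ht.2
      ((h' t ht.1 (le_csSup hbdd ht) (by linarith)).trans ENNReal.coe_lt_top).ne⟩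
  rcases hτ.2.eq_or_lt with heq | hlt
  · rw [← heq]; exact hτT.2
  · obtain ⟨η, hη, h'⟩ := hf _ hτ 1 one_pos
    have hη' : (0 : ℝ) < η := by exact_mod_cast hη
    have h1 : sSup T < min b (sSup T + η / 2) := lt_min hlt (by linarith)
    have h2 : min b (sSup T + η / 2) ∈ Set.Icc a b := ⟨hτ.1.trans h1.le, min_le_left _ _⟩
    have h3 : min b (sSup T + η / 2) < sSup T + η := (min_le_right _ _).trans_lt (by linarith)
    have h4 : min b (sSup T + η / 2) ∈ T :=
      ⟨h2, hd.fin_trans hτT.2 ((h' _ h2 h1.le h3).trans ENNReal.coe_lt_top).ne⟩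
    exact absurd (le_csSup hbdd h4) (not_le.2 h1)

theorem length_flip (P : ℝ → X) (a b : ℝ) :
    length (fun x y => d y x) (fun t => P (-t)) (-b) (-a) = length d P a b := by
  unfold length
  congr 1
  funext N
  unfold gridSum
  rw [← Finset.sum_range_reflect]
  refine Finset.sum_congr rfl fun i hi => ?_
  have hi := Finset.mem_range.1 hi
  have hN : (N : ℝ) ≠ 0 := by
    have : N ≠ 0 := by omega
    exact_mod_cast this
  have h1 : ((N - 1 - i : ℕ) : ℝ) = N - 1 - i := by
    rw [Nat.sub_sub, Nat.cast_sub (by omega)]; push_cast; ring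
  have h2 : -(-b + ((N - 1 - i + 1 : ℕ) : ℝ) * (-a - -b) / N) = a + (i : ℝ) * (b - a) / N := by
    push_cast [h1]; field_simp; ring
  have h3 : -(-b + ((N - 1 - i : ℕ) : ℝ) * (-a - -b) / N) =
      a + ((i + 1 : ℕ) : ℝ) * (b - a) / N := by
    push_cast [h1]; field_simp; ring
  dsimp only
  rw [h2, h3]

/-! ### Geodesics and their parametrizations by arc length -/

theorem Geo.isGeodesicImage (hd : IsSemimetric d) (h : Geo d g L x y) :
    IsGeodesicImage d (g '' Set.Icc 0 L) x y := by
  rcases h.nonneg.eq_or_lt with rfl | hL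
  · have hxy : x = y := h.left.symm.trans h.right
    have hxx : d x x = 0 := (hd.eq_zero_iff x x).2 rfl
    refine ⟨fun _ => x, 0, 1, ⟨⟨one_pos, ?_⟩, rfl, hxy, ?_⟩, ?_⟩
    · rw [isBicontinuousOn_iff hd]
      simp only [hxx]
      exact ⟨fun _ _ ε hε => ⟨1, one_pos, fun _ _ _ _ => by exact_mod_cast hε⟩,
        fun _ _ ε hε => ⟨1, one_pos, fun _ _ _ _ => by exact_mod_cast hε⟩⟩
    · rw [← hxy, hxx]
      refine Filter.Tendsto.limUnder_eq ?_
      have : gridSum d (fun _ => x) 0 1 = fun _ => 0 := by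
        funext N
        simp [gridSum, hxx]
      rw [this]
      exact tendsto_const_nhds
    · have : (Set.Icc (0 : ℝ) 1).Nonempty := ⟨0, by simp⟩
      rw [this.image_const, Set.Icc_self, Set.image_singleton, h.left]
  · have hbi : IsBicontinuousOn d g (Set.Icc 0 L) := by
      rw [isBicontinuousOn_iff hd]
      have key : ∀ s ∈ Set.Icc 0 L, ∀ t ∈ Set.Icc 0 L, ∀ ε : ℝ≥0, s ≤ t → t < s + ε →
          d (g s) (g t) < ε := by
        intro s hs t ht ε hst hlt
        rw [h.dist_eq s t hs.1 hst ht.2, ENNReal.ofReal_lt_coe_iff (by linarith)]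
        linarith
      exact ⟨fun s hs ε hε => ⟨ε, hε, fun t ht h1 h2 => key s hs t ht ε h1 h2⟩,
        fun t ht ε hε => ⟨ε, hε, fun s hs h1 h2 => key s hs t ht ε h1 h2⟩⟩
    refine ⟨g, 0, L, ⟨⟨hL, hbi⟩, h.left, h.right, ?_⟩, rfl⟩
    refine Filter.Tendsto.limUnder_eq ?_
    refine tendsto_const_nhds.congr' ?_
    filter_upwards [Filter.eventually_gt_atTop 0] with N hN
    have hN' : (0 : ℝ) < N := by exact_mod_cast hN
    have hterm : ∀ i ∈ Finset.range N,
        d (g (0 + (i : ℝ) * (L - 0) / N)) (g (0 + ((i + 1 : ℕ) : ℝ) * (L - 0) / N)) =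
          ENNReal.ofReal (L / N) := by
      intro i hi
      have hi' : ((i + 1 : ℕ) : ℝ) ≤ N := by exact_mod_cast Finset.mem_range.1 hi
      rw [h.dist_eq]
      · congr 1; push_cast; field_simp; ring
      · rw [zero_add, sub_zero]; positivity
      · have : (i : ℝ) ≤ (i + 1 : ℕ) := by push_cast; linarith
        rw [sub_zero]
        gcongr
      · rw [zero_add, sub_zero, div_le_iff₀ hN']
        nlinarith
    unfold gridSum
    rw [Finset.sum_congr rfl hterm, Finset.sum_const, Finset.card_range, nsmul_eq_mul,
      ← ENNReal.ofReal_natCast, ← ENNReal.ofReal_mul hN'.le]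
    have h0 := h.dist_eq 0 L le_rfl hL.le le_rfl
    rw [h.left, h.right, sub_zero] at h0
    rw [h0]
    congr 1
    field_simp

theorem IsGeodesic.exists_geo (hd : IsSemimetric d) {P : ℝ → X} {a b : ℝ}
    (h : IsGeodesic d P a b x y) (hxy : d x y ≠ ⊤) : ∃ g L, Geo d g L x y := by
  obtain ⟨hP, rfl, rfl, hlen⟩ := h
  obtain ⟨hf, hb⟩ := (isBicontinuousOn_iff hd P _).1 hP.2
  have hab := hP.1
  have fin0 : ∀ t ∈ Set.Icc a b, d (P a) (P t) ≠ ⊤ := by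
    intro t ht htop
    have := hP.add_le_length hd le_rfl ht.1 ht.2
    rw [hlen, htop] at this
    simp at this
    exact hxy this
  have hadd : ∀ s t, a ≤ s → s ≤ t → t ≤ b → d (P a) (P s) + d (P s) (P t) = d (P a) (P t) := by
    intro s t has hst htb
    refine le_antisymm ?_ (hd.triangle _ _ _)
    have h1 := hP.add_le_length hd has hst htb
    rw [hlen] at h1
    have h2 := hd.triangle (P a) (P b) (P t)
    have h3 : d (P t) (P b) ≠ ⊤ := by
      intro htop
      rw [htop, add_top] at h1
      exact hxy (top_le_iff.1 h1)
    exact (ENNReal.add_le_add_iff_right h3).1 (h1.trans h2)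
  have hst_fin : ∀ s t, a ≤ s → s ≤ t → t ≤ b → d (P s) (P t) ≠ ⊤ := by
    intro s t has hst htb htop
    have h1 := hadd s t has hst htb
    rw [htop, add_top] at h1
    exact fin0 t ⟨has.trans hst, htb⟩ h1.symm
  -- the arc length along `P`
  let φ : ℝ → ℝ := fun t => (d (P a) (P t)).toReal
  have hφ : ∀ s t, a ≤ s → s ≤ t → t ≤ b → φ t - φ s = (d (P s) (P t)).toReal := by
    intro s t has hst htb
    simp only [φ]
    rw [← hadd s t has hst htb, ENNReal.toReal_add (fin0 s ⟨has, hst.trans htb⟩)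
      (hst_fin s t has hst htb)]
    ring
  have hφmono : ∀ s t, a ≤ s → s ≤ t → t ≤ b → φ s ≤ φ t := by
    intro s t has hst htb
    have := hφ s t has hst htb
    have : 0 ≤ (d (P s) (P t)).toReal := ENNReal.toReal_nonneg
    linarith
  have hcont : ContinuousOn φ (Set.Icc a b) := by
    rw [Metric.continuousOn_iff]
    intro s hs ε hε
    lift ε to ℝ≥0 using hε.le
    obtain ⟨η₁, hη₁, h₁⟩ := hf s hs ε (by exact_mod_cast hε)
    obtain ⟨η₂, hη₂, h₂⟩ := hb s hs ε (by exact_mod_cast hε)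
    refine ⟨min η₁ η₂, lt_min (by exact_mod_cast hη₁) (by exact_mod_cast hη₂), ?_⟩
    intro t ht hts
    rw [Real.dist_eq] at hts ⊢
    have e1 := hts.trans_le (min_le_left _ _)
    have e2 := hts.trans_le (min_le_right _ _)
    rw [abs_lt] at e1 e2
    have conv : ∀ {u v : X}, d u v < ε → (d u v).toReal < ε := by
      intro u v huv
      have := (ENNReal.toReal_lt_toReal (huv.trans ENNReal.coe_lt_top).ne
        ENNReal.coe_ne_top).2 huv
      simpa using this
    rcases le_total s t with hle | hle
    · have := conv (h₁ t ht hle (by linarith))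
      rw [← hφ s t hs.1 hle ht.2] at this
      rw [abs_of_nonneg (by linarith [hφmono s t hs.1 hle ht.2])]
      exact this
    · have := conv (h₂ t ht hle (by linarith))
      rw [← hφ t s ht.1 hle hs.2] at this
      rw [abs_of_nonpos (by linarith [hφmono t s ht.1 hle hs.2])]
      linarith
  have hφa : φ a = 0 := by simp [φ, (hd.eq_zero_iff (P a) (P a)).2 rfl]
  have hivt : ∀ l : ℝ, ∃ t, l ∈ Set.Icc 0 (φ b) → t ∈ Set.Icc a b ∧ φ t = l := by
    intro l
    by_cases hl : l ∈ Set.Icc 0 (φ b)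
    · rw [← hφa] at hl
      obtain ⟨t, ht, htl⟩ := intermediate_value_Icc hab.le hcont hl
      exact ⟨t, fun _ => ⟨ht, htl⟩⟩
    · exact ⟨0, fun h => absurd h hl⟩
  choose τ hτ using hivt
  have hL : 0 ≤ φ b := ENNReal.toReal_nonneg
  have hzero : ∀ {u v : X}, d u v ≠ ⊤ → (d u v).toReal = 0 → u = v := by
    intro u v huv h0
    refine (hd.eq_zero_iff u v).1 ?_
    rcases (ENNReal.toReal_eq_zero_iff _).1 h0 with h | h
    · exact h
    · exact absurd h huv
  refine ⟨fun l => P (τ l), φ b, hL, ?_, ?_, ?_⟩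
  · obtain ⟨h1, h2⟩ := hτ 0 ⟨le_rfl, hL⟩
    exact (hzero (fin0 _ h1) h2).symm
  · obtain ⟨h1, h2⟩ := hτ (φ b) ⟨hL, le_rfl⟩
    refine hzero (hst_fin _ _ h1.1 h1.2 le_rfl) ?_
    rw [← hφ _ _ h1.1 h1.2 le_rfl, h2, sub_self]
  · intro s t hs hst ht
    obtain ⟨h1, h2⟩ := hτ s ⟨hs, hst.trans ht⟩
    obtain ⟨h3, h4⟩ := hτ t ⟨hs.trans hst, ht⟩
    rcases le_total (τ s) (τ t) with hle | hle
    · rw [← ENNReal.ofReal_toReal (hst_fin _ _ h1.1 hle h3.2), ← hφ _ _ h1.1 hle h3.2, h2, h4]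
    · have := hφmono _ _ h3.1 hle h1.2
      obtain rfl : s = t := le_antisymm hst (by linarith)
      simp [(hd.eq_zero_iff (P (τ s)) (P (τ s))).2 rfl]

theorem exists_thinSpace (hd : IsSemimetric d) (hgeo : IsGeodesicSpace d) (hhyp : IsHyperbolic d)
    (hB1 : BoundedOutBalls d) (hB2 : BoundedInBalls d) : ∃ δ f, ThinSpace d δ f := by
  obtain ⟨δ, hδ⟩ := hhyp
  obtain ⟨f₁, hf₁⟩ := hB1
  obtain ⟨f₂, hf₂⟩ := hB2
  have ball : ∀ {r : ℝ} {x y : X}, Near d r x y → d x y ≤ r.toNNReal := fun h =>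
    (near_iff h.nonneg).1 h
  refine ⟨δ, fun r => max (max (f₁ r) (f₂ r)) 0, δ.2, hd, ?_, ?_, ?_, ?_⟩
  · intro x y hxy
    obtain ⟨P, a, b, hP⟩ := hgeo x y hxy.lt_top
    exact hP.exists_geo hd hxy
  · intro x y z g L g₁ L₁ g₂ L₂ hg h₁ h₂ t ht0 ht
    have conv : ∀ {u v : X}, d u v ≤ δ → Near d δ u v := fun huv =>
      (near_iff δ.2).2 (by simpa using huv)
    rcases hδ x y z _ _ _ (hg.isGeodesicImage hd)
      (h₁.imp (Geo.isGeodesicImage hd) (Geo.isGeodesicImage hd))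
      (h₂.imp (Geo.isGeodesicImage hd) (Geo.isGeodesicImage hd))
      (Set.mem_image_of_mem g ⟨ht0, ht⟩) with h | h
    · obtain ⟨_, ⟨s, hs, rfl⟩, hst⟩ := Set.mem_iUnion₂.1 h
      exact Or.inl ⟨s, hs.1, hs.2, conv hst⟩
    · obtain ⟨_, ⟨s, hs, rfl⟩, hst⟩ := Set.mem_iUnion₂.1 h
      exact Or.inr ⟨s, hs.1, hs.2, conv hst⟩
  · intro x y z r hy hz hyz
    have h1 := (hf₁ x r.toNNReal y (ball hy) z (ball hz)).resolve_left hyz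
    rw [Real.coe_toNNReal r hy.nonneg] at h1
    exact (near_iff (le_max_right _ _)).2 (h1.trans (ENNReal.ofReal_le_ofReal
      ((le_max_left _ _).trans (le_max_left _ _))))
  · intro x y z r hy hz hyz
    have h1 := (hf₂ x r.toNNReal y (ball hy) z (ball hz)).resolve_left hyz
    rw [Real.coe_toNNReal r hy.nonneg] at h1
    exact (near_iff (le_max_right _ _)).2 (h1.trans (ENNReal.ofReal_le_ofReal
      ((le_max_right _ _).trans (le_max_left _ _))))

/-! ### Discretization of quasi-geodesic rays and anti-rays -/

/-- The next point at distance one on a ray. -/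
theorem IsRay.exists_next (hd : IsSemimetric d) {R : ℝ → X} (hR : IsRay d R) (ht : 0 ≤ t) :
    ∃ t', t < t' ∧ 1 ≤ d (R t) (R t') ∧ ∀ s, t ≤ s → s ≤ t' → d (R t) (R s) ≤ 1 := by
  obtain ⟨hf, hb⟩ := (isBicontinuousOn_iff hd R _).1 hR.1
  have hself : d (R t) (R t) = 0 := (hd.eq_zero_iff _ _).2 rfl
  set A := {u | t ≤ u ∧ ∀ s, t ≤ s → s ≤ u → d (R t) (R s) ≤ 1} with hA
  have htA : t ∈ A := by
    refine ⟨le_rfl, fun s h1 h2 => ?_⟩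
    rw [le_antisymm h2 h1, hself]
    exact zero_le
  have hbdd : BddAbove A := by
    obtain ⟨p, -, hp⟩ := hR.2 (R t) 1
    refine ⟨p, fun u hu => ?_⟩
    by_contra! hlt
    have : R u ∈ R '' Set.Ici p ∩ outBall d (R t) 1 :=
      ⟨⟨u, hlt.le, rfl⟩, by simpa [outBall] using hu.2 u hu.1 le_rfl⟩
    rw [hp] at this
    exact this
  set τ := sSup A with hτ
  have htτ : t ≤ τ := le_csSup hbdd htA
  have hlt : ∀ s, t ≤ s → s < τ → d (R t) (R s) ≤ 1 := by
    intro s hts hsτ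
    obtain ⟨u, hu, hsu⟩ := exists_lt_of_lt_csSup ⟨t, htA⟩ hsτ
    exact hu.2 s hts hsu.le
  have hle : ∀ s, t ≤ s → s ≤ τ → d (R t) (R s) ≤ 1 := by
    intro s hts hsτ
    rcases hts.eq_or_lt with rfl | hts'
    · rw [hself]; exact zero_le
    refine ENNReal.le_of_forall_pos_le_add fun ε hε _ => ?_
    obtain ⟨η, hη, h'⟩ := hb s (ht.trans hts) ε hε
    have hη' : (0 : ℝ) < η := by exact_mod_cast hη
    have h1 : max t (s - η / 2) < s := max_lt hts' (by linarith)
    have h2 := h' (max t (s - η / 2)) (ht.trans (le_max_left _ _)) h1.le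
      (by linarith [le_max_right t (s - η / 2)])
    exact (hd.triangle _ _ _).trans (add_le_add (hlt _ (le_max_left _ _) (h1.trans_le hsτ)) h2.le)
  have hge : 1 ≤ d (R t) (R τ) := by
    by_contra! hcon
    obtain ⟨ε, hε, hlt'⟩ := ENNReal.lt_iff_exists_add_pos_lt.1 hcon
    obtain ⟨η, hη, h'⟩ := hf τ (ht.trans htτ) ε hε
    have hη' : (0 : ℝ) < η := by exact_mod_cast hη
    have hmem : τ + η / 2 ∈ A := by
      refine ⟨by linarith, fun s hts hs => ?_⟩
      rcases le_total s τ with hsτ | hsτ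
      · exact hle s hts hsτ
      · exact (hd.triangle _ _ (R τ)).trans
          ((add_le_add le_rfl (h' s (ht.trans hts) hsτ (by linarith)).le).trans hlt'.le)
    linarith [le_csSup hbdd hmem]
  refine ⟨τ, htτ.lt_of_ne ?_, hge, hle⟩
  intro heq
  rw [← heq, hself] at hge
  simp at hge

theorem IsQuasiGeodesicRay.exists_isDQG (hd : IsSemimetric d) {R : ℝ → X}
    (hR : IsQuasiGeodesicRay d R) : ∃ (γ c : ℝ) (a : ℕ → X), IsDQG d γ c a ∧
      (∀ i, ∃ t, 0 ≤ t ∧ R t = a i) ∧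
      ∃ c', ∀ t, 0 ≤ t → ∃ k, Near d c' (a k) (R t) ∧ Near d c' (R t) (a (k + 1)) := by
  obtain ⟨hray, γ, c, -, hqg⟩ := hR
  have hnext : ∀ t : ℝ, ∃ t', 0 ≤ t → t < t' ∧ 1 ≤ d (R t) (R t') ∧
      ∀ s, t ≤ s → s ≤ t' → d (R t) (R s) ≤ 1 := by
    intro t
    by_cases ht : 0 ≤ t
    · obtain ⟨t', h'⟩ := hray.exists_next hd ht
      exact ⟨t', fun _ => h'⟩
    · exact ⟨0, fun h => absurd h ht⟩
  choose next hnext using hnext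
  let T : ℕ → ℝ := fun n => next^[n] 0
  have hT0 : T 0 = 0 := rfl
  have hTs : ∀ n, T (n + 1) = next (T n) := fun n => Function.iterate_succ_apply' next n 0
  have hTnn : ∀ n, 0 ≤ T n := by
    intro n
    induction n with
    | zero => exact hT0.ge
    | succ n ih => rw [hTs]; exact ih.trans (hnext _ ih).1.le
  have hTmono : StrictMono T := strictMono_nat_of_lt_succ fun n => by
    rw [hTs]; exact (hnext _ (hTnn n)).1
  have hstep1 : ∀ n, 1 ≤ d (R (T n)) (R (T (n + 1))) := fun n => by
    rw [hTs]; exact (hnext _ (hTnn n)).2.1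
  have hstep2 : ∀ n s, T n ≤ s → s ≤ T (n + 1) → Near d 1 (R (T n)) (R s) := by
    intro n s h1 h2
    rw [hTs] at h2
    exact (near_iff zero_le_one).2 (by simpa using (hnext _ (hTnn n)).2.2 s h1 h2)
  have hpath : ∀ {s t}, 0 ≤ s → s < t → IsDirectedPath d R s t := fun {s t} hs hst =>
    ⟨hst, hray.1.mono hd fun u hu => hs.trans hu.1⟩
  have hcount : ∀ {s t i n}, 0 ≤ s → s < t → s ≤ T i → T (i + n) ≤ t →
      (n : ℝ≥0∞) ≤ γ * d (R s) (R t) + c := by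
    intro s t i n hs hst hsi hit
    have hm : Monotone fun l => T (min (i + l) (i + n)) := by
      intro l l' hl
      exact hTmono.monotone (min_le_min_right _ (by omega))
    have h1 := (hpath hs hst).sum_le_length hd hm (fun l =>
      ⟨hsi.trans (hTmono.monotone (le_min (by omega) (by omega))),
        (hTmono.monotone (min_le_right _ _)).trans hit⟩) n
    refine le_trans ?_ (h1.trans (hqg s hs t (hs.trans hst.le) hst))
    calc (n : ℝ≥0∞) = ∑ _l ∈ Finset.range n, 1 := by simp
      _ ≤ _ := Finset.sum_le_sum fun l hl => by
        have hl := Finset.mem_range.1 hl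
        rw [min_eq_left (by omega), min_eq_left (by omega)]
        exact hstep1 (i + l)
  have hunb : ∀ t, 0 ≤ t → ∃ k, t < T k := by
    intro t ht
    by_contra! hcon
    have ht' : 0 < t := (hT0 ▸ hTmono (Nat.lt_succ_self 0)).trans_le (hcon 1)
    have hfin : (γ : ℝ≥0∞) * d (R 0) (R t) + c ≠ ⊤ := ENNReal.add_ne_top.2
      ⟨ENNReal.mul_ne_top ENNReal.coe_ne_top ((hpath le_rfl ht').2.fin hd ht), ENNReal.coe_ne_top⟩
    obtain ⟨n, hn⟩ := ENNReal.exists_nat_gt hfin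
    exact absurd (hcount (i := 0) (n := n) le_rfl ht' hT0.ge (hcon _)) (not_le.2 hn)
  have hdqg : IsDQG d γ c fun n => R (T n) := by
    refine ⟨γ.2, c.2, fun n => hstep2 n _ (hTmono.monotone (by omega)) le_rfl, ?_⟩
    have hfin : ∀ n, d (R (T n)) (R (T (n + 1))) ≠ ⊤ := fun n =>
      (hstep2 n _ (hTmono.monotone (by omega)) le_rfl).1
    intro i j hij
    rcases hij.eq_or_lt with rfl | hlt
    · have := mul_nonneg γ.2 (ENNReal.toReal_nonneg (a := d (R (T i)) (R (T i))))
      have := c.2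
      simp only [sub_self, NNReal.val_eq_coe] at *
      linarith
    have h1 := hcount (i := i) (n := j - i) (hTnn i) (hTmono hlt) le_rfl
      (by rw [Nat.add_sub_cancel' hij])
    have hf : d (R (T i)) (R (T j)) ≠ ⊤ := fin_of_steps (u := fun n => R (T n)) hd hfin hij
    have h2 : (γ : ℝ≥0∞) * d (R (T i)) (R (T j)) ≠ ⊤ := ENNReal.mul_ne_top ENNReal.coe_ne_top hf
    have h3 := ENNReal.toReal_mono (ENNReal.add_ne_top.2 ⟨h2, ENNReal.coe_ne_top⟩) h1
    rw [ENNReal.toReal_add h2 ENNReal.coe_ne_top, ENNReal.toReal_mul] at h3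
    rw [ENNReal.toReal_natCast, Nat.cast_sub hij] at h3
    simpa only [ENNReal.coe_toReal] using h3
  refine ⟨γ, c, fun n => R (T n), hdqg, fun i => ⟨T i, hTnn i, rfl⟩, 1 + (γ + c), ?_⟩
  intro t ht
  obtain ⟨k, hk1, hk2⟩ : ∃ k, T k ≤ t ∧ t < T (k + 1) := by
    classical
    have hex := hunb t ht
    have hpos : Nat.find hex ≠ 0 := by
      intro h0
      have := Nat.find_spec hex
      rw [h0, hT0] at this
      linarith
    obtain ⟨k, hk⟩ := Nat.exists_eq_succ_of_ne_zero hpos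
    refine ⟨k, not_lt.1 (Nat.find_min hex (by omega)), ?_⟩
    have := Nat.find_spec hex
    rwa [hk] at this
  have hγ := γ.2
  have hc := c.2
  simp only [NNReal.val_eq_coe] at hγ hc
  refine ⟨k, (hstep2 k t hk1 hk2.le).mono (by linarith), ?_⟩
  refine Near.mono (r := γ + c) ((near_iff (by linarith)).2 ?_) (by linarith)
  have hTk : T k < T (k + 1) := hk1.trans_lt hk2
  have h1 := (hpath (hTnn k) hTk).add_le_length hd hk1 hk2.le le_rfl
  have h2 := hqg _ (hTnn k) _ (hTnn (k + 1)) hTk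
  have h3 := (near_iff zero_le_one).1 (hstep2 k _ hTk.le le_rfl)
  rw [ENNReal.ofReal_one] at h3
  calc d (R t) (R (T (k + 1))) ≤ length d R (T k) (T (k + 1)) :=
        le_trans (by rw [add_assoc]; exact le_add_self.trans' le_self_add) h1
    _ ≤ γ * 1 + c := h2.trans (by gcongr)
    _ = ENNReal.ofReal (γ + c) := by
      rw [mul_one, ENNReal.ofReal_add hγ hc, ENNReal.ofReal_coe_nnreal, ENNReal.ofReal_coe_nnreal]

/-- Anti-rays are rays for the reversed semimetric. -/
theorem IsQuasiGeodesicAntiRay.flip (hd : IsSemimetric d) {R : ℝ → X}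
    (hR : IsQuasiGeodesicAntiRay d R) :
    IsQuasiGeodesicRay (fun x y => d y x) fun t => R (-t) := by
  obtain ⟨⟨hbi, hesc⟩, γ, c, hγ, hqg⟩ := hR
  rw [isBicontinuousOn_iff hd] at hbi
  refine ⟨⟨?_, fun x r => ?_⟩, γ, c, hγ, fun s hs t ht hst => ?_⟩
  · rw [isBicontinuousOn_iff hd.flip]
    constructor
    · intro s hs ε hε
      obtain ⟨η, hη, h'⟩ := hbi.2 (-s) (Set.mem_Iic.2 (neg_nonpos.2 hs)) ε hε
      exact ⟨η, hη, fun t ht h1 h2 => h' (-t) (Set.mem_Iic.2 (neg_nonpos.2 ht)) (by linarith)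
        (by linarith)⟩
    · intro s hs ε hε
      obtain ⟨η, hη, h'⟩ := hbi.1 (-s) (Set.mem_Iic.2 (neg_nonpos.2 hs)) ε hε
      exact ⟨η, hη, fun t ht h1 h2 => h' (-t) (Set.mem_Iic.2 (neg_nonpos.2 ht)) (by linarith)
        (by linarith)⟩
  · obtain ⟨p, hp, hp'⟩ := hesc x r
    refine ⟨-p, by linarith, Set.eq_empty_of_forall_notMem ?_⟩
    rintro _ ⟨⟨t, ht, rfl⟩, hmem⟩
    have : R (-t) ∈ R '' Set.Iic p ∩ inBall d x r :=
      ⟨⟨-t, Set.mem_Iic.2 (by linarith [Set.mem_Ici.1 ht]), rfl⟩, hmem⟩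
    rw [hp'] at this
    exact this
  · have h1 := hqg (-t) (Set.mem_Iic.2 (neg_nonpos.2 ht)) (-s) (Set.mem_Iic.2 (neg_nonpos.2 hs))
      (by linarith)
    have h2 := length_flip (d := d) R (-t) (-s)
    rw [neg_neg, neg_neg] at h2
    rw [h2]
    exact h1

/-- The sequence `a` of points of `R` is a discrete quasi-geodesic such that every point of `R` is
within a bounded distance of points of `a` with consecutive indices, in both directions. -/
structure IsDiscretization (d : X → X → ℝ≥0∞) (R : RayOrAntiRay d) (a : ℕ → X) : Prop where
  isDQGEither : IsDQGEither d a
  mem : ∀ i, a i ∈ trace d R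
  exists_near : ∃ c : ℝ, ∀ u ∈ trace d R, ∃ k l, l ≤ k + 1 ∧ Near d c (a k) u ∧ Near d c u (a l)

theorem exists_isDiscretization (hd : IsSemimetric d) (R : RayOrAntiRay d) :
    ∃ a, IsDiscretization d R a := by
  rcases R with ⟨R, hR⟩ | ⟨R, hR⟩
  · obtain ⟨γ, c, a, ha, hmem, c', hc'⟩ := hR.exists_isDQG hd
    refine ⟨a, ⟨γ, c, Or.inl ha⟩, fun i => ?_, c', ?_⟩
    · obtain ⟨t, ht, hta⟩ := hmem i
      exact ⟨t, ht, hta⟩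
    · rintro _ ⟨t, ht, rfl⟩
      obtain ⟨k, h1, h2⟩ := hc' t ht
      exact ⟨k, k + 1, le_rfl, h1, h2⟩
  · obtain ⟨γ, c, a, ha, hmem, c', hc'⟩ := (hR.flip hd).exists_isDQG hd.flip
    refine ⟨a, ⟨γ, c, Or.inr ha⟩, fun i => ?_, c', ?_⟩
    · obtain ⟨t, ht, hta⟩ := hmem i
      exact ⟨-t, Set.mem_Iic.2 (by linarith), hta⟩
    · rintro _ ⟨t, ht, rfl⟩
      obtain ⟨k, h1, h2⟩ := hc' (-t) (by linarith [Set.mem_Iic.1 ht])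
      rw [neg_neg] at h1 h2
      exact ⟨k + 1, k, by omega, h2, h1⟩

/-! ### Comparison of the two relations -/

theorem RayLE.seqLE (h : ThinSpace d δ fun r => C * (r + 1)) (hC : 1 ≤ C) {R₁ R₂ : RayOrAntiRay d}
    {a b : ℕ → X} (ha : IsDiscretization d R₁ a) (hb : IsDiscretization d R₂ b)
    (hle : RayLE d R₁ R₂) : SeqLE d a b := by
  have hd := h.semi
  obtain ⟨M, hM⟩ := hle
  obtain ⟨c₁, hc₁⟩ := ha.exists_near
  obtain ⟨c₂, hc₂⟩ := hb.exists_near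
  refine ⟨c₁ + M + c₂, fun N => ?_⟩
  -- far points of `a` are not close to one of the first points of `b`
  have hev : ∀ᶠ i in Filter.atTop, ∀ j ∈ Finset.range N, ¬ Near d (c₁ + M + c₂) (a i) (b j) :=
    (Filter.eventually_all_finset _).2 fun j _ =>
      (ha.isDQGEither.eventually_not_near h hC (b j) _).mono fun _ hi => hi.2
  obtain ⟨N', hN'⟩ := Filter.eventually_atTop.1 hev
  -- a path that avoids a large ball around `a 0` starts far out
  obtain ⟨ρ, hρ⟩ : ∃ ρ : ℝ≥0, ∀ u k l, l ≤ k + 1 → Near d c₁ (a k) u → Near d c₁ u (a l) →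
      k < max N N' → u ∈ outBall d (a 0) ρ ∪ inBall d (a 0) ρ := by
    refine ⟨((max N N' : ℕ) + c₁).toNNReal, fun u k l hlk h1 h2 hk => ?_⟩
    have hnn : (0 : ℝ) ≤ (max N N' : ℕ) := Nat.cast_nonneg _
    have conv : ∀ {x y : X}, Near d ((max N N' : ℕ) + c₁) x y →
        d x y ≤ (((max N N' : ℕ) + c₁).toNNReal : ℝ≥0) := fun hn => (near_iff hn.nonneg).1 hn
    have hk' : (k : ℝ) ≤ (max N N' : ℕ) := by exact_mod_cast hk.le
    have hl' : (l : ℝ) ≤ (max N N' : ℕ) := by exact_mod_cast (by omega : l ≤ max N N')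
    obtain ⟨γ, c, hdq | hdq⟩ := ha.isDQGEither
    · refine Or.inl (conv (((hdq.near hd (Nat.zero_le k)).trans hd h1).mono ?_))
      push_cast at *; linarith
    · have h0 : Near d ((l : ℝ) - (0 : ℕ)) (a l) (a 0) := hdq.near hd.flip (Nat.zero_le l)
      refine Or.inr (conv ((h2.trans hd h0).mono ?_))
      push_cast at *; linarith
  obtain ⟨P, α, β, hP, hPα, hPβ, hlen, havoid⟩ := hM ρ (a 0)
  obtain ⟨k, l, hlk, hk, hl⟩ := hc₁ _ hPα
  obtain ⟨k', l', -, hk', hl'⟩ := hc₂ _ hPβ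
  have hPP : Near d M (P α) (P β) := by
    refine (near_iff M.2).2 ?_
    have h1 := hP.add_le_length hd le_rfl hP.1.le le_rfl
    have h2 : d (P α) (P β) ≤ length d P α β :=
      le_trans (le_self_add.trans' le_add_self) h1
    simpa using h2.trans hlen
  have hkN : max N N' ≤ k := by
    by_contra! hlt
    exact havoid α ⟨le_rfl, hP.1.le⟩ (hρ _ k l hlk hk hl hlt)
  have hn := (hk.trans hd hPP).trans hd hl'
  refine ⟨k, l', (le_max_left _ _).trans hkN, ?_, hn⟩
  by_contra! hlt
  exact hN' k ((le_max_right _ _).trans hkN) l' (Finset.mem_range.2 hlt) hn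

theorem SeqLE.rayLE (h : ThinSpace d δ fun r => C * (r + 1)) (hC : 1 ≤ C)
    (hgeo : IsGeodesicSpace d) {R₁ R₂ : RayOrAntiRay d} {a b : ℕ → X}
    (ha : IsDiscretization d R₁ a) (hb : IsDiscretization d R₂ b) (hle : SeqLE d a b) :
    RayLE d R₁ R₂ := by
  have hd := h.semi
  obtain ⟨M, hM⟩ := hle
  refine ⟨M.toNNReal, fun r x => ?_⟩
  obtain ⟨N, hN⟩ := Filter.eventually_atTop.1
    ((ha.isDQGEither.eventually_not_near h hC x (r + M)).and
      (hb.isDQGEither.eventually_not_near h hC x (r + M)))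
  obtain ⟨i, j, hi, hj, hij⟩ := hM N
  obtain ⟨P, α, β, hP, hPα, hPβ, hlen⟩ := hgeo _ _ hij.1.lt_top
  have hdM : d (a i) (b j) ≤ M.toNNReal := (near_iff hij.nonneg).1 hij
  refine ⟨P, α, β, hP, hPα ▸ ha.mem i, hPβ ▸ hb.mem j, hlen ▸ hdM, fun t ht hmem => ?_⟩
  have h1 := hP.add_le_length hd le_rfl ht.1 ht.2
  rw [hPα, hPβ, hlen] at h1
  have conv : ∀ {u v : X}, d u v ≤ r → Near d r u v := fun huv =>
    (near_iff r.2).2 (by simpa using huv)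
  rcases hmem with hmem | hmem
  · have h2 : Near d M (P t) (b j) :=
      (near_iff hij.nonneg).2 ((le_add_self.trans h1).trans hdM)
    exact (hN j hj).2.1 ((conv hmem).trans hd h2)
  · have h2 : Near d M (a i) (P t) :=
      (near_iff hij.nonneg).2 (((le_add_self.trans le_self_add).trans h1).trans hdM)
    exact (hN i hi).1.2 ((h2.trans hd (conv hmem)).mono (by linarith))

end Semi

theorem mainTheorem2 {X : Type*} (d : X → X → ℝ≥0∞) (hd : Semi.IsSemimetric d)
    (hgeo : Semi.IsGeodesicSpace d) (hhyp : Semi.IsHyperbolic d)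
    (hB1 : Semi.BoundedOutBalls d) (hB2 : Semi.BoundedInBalls d) :
    IsPreorder (Semi.RayOrAntiRay d) (Semi.RayLE d) := by
  obtain ⟨δ, f, h⟩ := Semi.exists_thinSpace hd hgeo hhyp hB1 hB2
  obtain ⟨C, hC, h⟩ := h.exists_linear
  refine { refl := fun R => ?_, trans := fun R₁ R₂ R₃ h₁₂ h₂₃ => ?_ }
  · obtain ⟨a, ha⟩ := Semi.exists_isDiscretization hd R
    exact (Semi.SeqLE.refl hd a).rayLE h hC hgeo ha ha
  · obtain ⟨a, ha⟩ := Semi.exists_isDiscretization hd R₁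
    obtain ⟨b, hb⟩ := Semi.exists_isDiscretization hd R₂
    obtain ⟨e, he⟩ := Semi.exists_isDiscretization hd R₃
    exact ((h₁₂.seqLE h hC ha hb).trans h hC ha.isDQGEither hb.isDQGEither he.isDQGEither
      (h₂₃.seqLE h hC hb he)).rayLE h hC hgeo ha he
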